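/- For a family $\mathcal F$ of finite sets and a positive integer $t$, let $\nu(\mathcal F,t)$ be the maximum $m$ for which there are (not necessarily distinct) $F_1,\dots,F_m\in\mathcal F$ with $|F_i\cap F_j|\le t-1$ for all $1\le i<j\le m$ (and $\nu(\mathcal F,t)=\infty$ if there is no maximum, i.e. if $\mathcal F$ contains a set of size less than $t$). For families $\mathcal F,\mathcal S$ let $\mathcal F[\mathcal S]=\{F\in\mathcal F: X\subset F\text{ for some }X\in\mathcal S\}$. There is an absolute constant $C>0$ such that the following holds. Let $n\ge0$, $s\ge1$ and $k\ge t\ge 1$ be integers and let $\sigma\ge 0$ be a real number, with $st+\sigma\ge 2$, such that $$n\ge t+C(st)^{1/2}(k-t)\log_2\frac{n-t}{k-t}\qquad\text{and}\qquad n\ge k+C(k-t)s(\sigma+\log_2 n),$$ where $(k-t)\log_2\frac{n-t}{k-t}$ is read as $0$ if $k=t$. Let $\mathcal F\subset\binom{[n]}{k}$ satisfy $\nu(\mathcal F,t)\le s$. Then there is a family $\mathcal S$ of subsets of $[n]$, each of size at most $$t+(t/s)^{1/2}+3\sigma+\log_2(16s^4t^2),$$ such that $\nu(\mathcal S,t)\le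 s$ and $$|\mathcal F\setminus\mathcal F[\mathcal S]|\le 2^{-\sigma}\cdot 15\log_2(st+\sigma)\cdot\binom{n-t}{k-t}.$$ More generally, if additionally $n\ge t+Ct^{\alpha}s^{\beta}(k-t)\log_2\frac{n-t}{k-t}$ for some real $\alpha,\beta\ge 1/2$, then there is a family $\mathcal S$ of subsets of $[n]$, each of size at most $$t+t^{1-\alpha}s^{-\beta}+3\sigma+\log_2(16s^4t^2),$$ with $\nu(\mathcal S,t)\le s$ and the same bound on $|\mathcal F\setminus\mathcal F[\mathcal S]|$. -/

import Mathlib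

namespace SetFamily

variable {V : Type*} [DecidableEq V]

/-- `matchingNumber F t` is the largest `m` for which there are (not necessarily distinct) members
`A₁, …, A_m` of `F` with `|A_i ∩ A_j| ≤ t - 1` for all `i < j`; it is `⊤` if there is no largest
such `m`, which happens exactly when `F` has a member with fewer than `t` elements. -/
noncomputable def matchingNumber (F : Finset (Finset V)) (t : ℕ) : ℕ∞ :=
  ⨆ (m : ℕ) (_ : ∃ A : Fin m → Finset V,
    (∀ i, A i ∈ F) ∧ ∀ i j, i < j → (A i ∩ A j).card < t), (m : ℕ∞)

/-- `F[X]`, the members of `F` that contain the set `X`. -/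
def containing (F : Finset (Finset V)) (X : Finset V) : Finset (Finset V) :=
  F.filter (fun A => X ⊆ A)

/-- `F[S]`, the union of `F[X]` over `X ∈ S`. -/
def containingSome (F S : Finset (Finset V)) : Finset (Finset V) :=
  S.biUnion (fun X => containing F X)

end SetFamily

namespace SetFamily

open Finset

/-! Put r = (n-t)/(k-t) and τ = r/2^12. A core of a family is a set X such that some subfamily, all
of whose members contain X, is τ-spread outside X: prescribing a further set Z costs a factor τ^|Z|.
The approximating family consists of the cores of F of size at most t + d₀, where t + d₀ is the
allowed size rounded down.

Matching number. Suppose s+1 cores had pairwise intersections below t. Discard from each spread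
subfamily the members meeting another core too much; at least half remains. The spread lemma
(`exists_pairwise_disjoint_of_spread`) then picks one member over each core, pairwise disjoint
outside their cores. These members intersect pairwise in fewer than t points, contradicting ν(F,t) ≤
s (`exists_lt_card_inter_add_of_isCore`). The spread lemma is proved by a random colouring: exposing
one colour class at least halves the average size of what is still uncovered.

Remainder. Members above no small core form a family R whose cores all exceed t + d₀. By
`exists_isCore_superset` every set contained in a member of R lies below a core, so large cores make
all degrees of R small. If all cores have size at least t + d, the members above a core of size at
most t + 2d are counted by choosing two such cores greedily
(`card_containingSome_coresOfCardLE_le`); removing them doubles d, and the losses form a geometric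
series (`card_le_of_cores_large`).

The resulting bound is 2^(-σ) times the binomial coefficient; the factor 15 log₂(st+σ) is not
needed. -/

theorem sum_large_subsets_le {V : Type*} (S : Finset V) {M R : ℝ} (hM : 0 ≤ M) (hR : 0 < R)
    (hMR : 2 ^ 11 * M ≤ R) :
    ∑ T ∈ S.powerset.filter (fun T => S.card < 4 * T.card), (T.card : ℝ) * (M / R) ^ T.card
      ≤ 1 / 4 := by
  have hx : M / R ≤ (1 / 2) ^ 11 := by
    rw [div_le_iff₀ hR]; linarith
  have hx0 : 0 ≤ M / R := by positivity
  -- The factor 2^(-|S|) pays for the number of subsets of S; it is available because 4|T| > |S|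
  -- forces 10|T| ≥ |S| + 2.
  have hterm : ∀ T ∈ S.powerset.filter (fun T => S.card < 4 * T.card),
      (T.card : ℝ) * (M / R) ^ T.card ≤ 1 / 4 * (1 / 2) ^ S.card := by
    intro T hT
    have hT' := (mem_filter.1 hT).2
    have h1 : (T.card : ℝ) ≤ 2 ^ T.card := by exact_mod_cast Nat.lt_two_pow_self.le
    calc (T.card : ℝ) * (M / R) ^ T.card ≤ 2 ^ T.card * ((1 / 2) ^ 11) ^ T.card := by gcongr
      _ = ((1 / 2 : ℝ)) ^ (10 * T.card) := by
          rw [← mul_pow, pow_mul]; norm_num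
      _ ≤ (1 / 2) ^ (2 + S.card) := by
          apply pow_le_pow_of_le_one (by norm_num) (by norm_num); omega
      _ = _ := by rw [pow_add]; norm_num
  calc _ ≤ ∑ T ∈ S.powerset.filter (fun T => S.card < 4 * T.card),
        (1 / 4 * (1 / 2 : ℝ) ^ S.card) := sum_le_sum hterm
    _ ≤ ∑ T ∈ S.powerset, (1 / 4 * (1 / 2 : ℝ) ^ S.card) :=
        sum_le_sum_of_subset_of_nonneg (filter_subset _ _) (fun _ _ _ => by positivity)
    _ = 1 / 4 := by
        rw [sum_const, card_powerset, nsmul_eq_mul]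
        push_cast
        rw [mul_left_comm, ← mul_pow]; norm_num

/-! ### Spread lemma: fragments and random colour classes -/

section Spread

variable {V Ω : Type*} [DecidableEq V]

/-- The restriction |A ω'| ≤ |A ω| lets a fragment that is large relative to A ω also be large
relative to the smallest member inside the covered set; the encoding of large fragments rests on
this. -/
theorem exists_fragment_index (A : Ω → Finset V) (W : Finset V) (ω : Ω) :
    ∃ ω', A ω' ⊆ W ∪ A ω ∧ (A ω').card ≤ (A ω).card ∧
      ∀ ω'', A ω'' ⊆ W ∪ A ω → (A ω'').card ≤ (A ω).card →
        (A ω' \ W).card ≤ (A ω'' \ W).card := by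
  have h : ∃ m ω', (A ω' ⊆ W ∪ A ω ∧ (A ω').card ≤ (A ω).card) ∧ (A ω' \ W).card = m :=
    ⟨_, ω, ⟨subset_union_right, le_rfl⟩, rfl⟩
  classical
  obtain ⟨ω', ⟨h1, h2⟩, h3⟩ := Nat.find_spec h
  refine ⟨ω', h1, h2, fun ω'' h4 h5 => ?_⟩
  rw [h3]
  exact Nat.find_min' h ⟨ω'', ⟨h4, h5⟩, rfl⟩

/-- A smallest set `A ω' \ W` with `A ω' ⊆ W ∪ A ω` and `|A ω'| ≤ |A ω|`. -/
noncomputable def fragment (A : Ω → Finset V) (W : Finset V) (ω : Ω) : Finset V :=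
  A (exists_fragment_index A W ω).choose \ W

theorem fragment_subset (A : Ω → Finset V) (W : Finset V) (ω : Ω) :
    fragment A W ω ⊆ A ω := by
  intro x hx
  rw [fragment, mem_sdiff] at hx
  have := (exists_fragment_index A W ω).choose_spec.1 hx.1
  rw [mem_union] at this
  tauto

theorem disjoint_fragment (A : Ω → Finset V) (W : Finset V) (ω : Ω) :
    Disjoint (fragment A W ω) W := sdiff_disjoint

theorem exists_subset_fragment_union (A : Ω → Finset V) (W : Finset V) (ω : Ω) :
    ∃ ω', A ω' ⊆ fragment A W ω ∪ W ∧ (A ω').card ≤ (A ω).card := by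
  refine ⟨_, ?_, (exists_fragment_index A W ω).choose_spec.2.1⟩
  rw [fragment, sdiff_union_self_eq_union]
  exact subset_union_left

theorem card_fragment_le (A : Ω → Finset V) (W : Finset V) {ω ω' : Ω}
    (h : A ω' ⊆ W ∪ A ω) (hc : (A ω').card ≤ (A ω).card) :
    (fragment A W ω).card ≤ (A ω' \ W).card :=
  (exists_fragment_index A W ω).choose_spec.2.2 ω' h hc

/-- Here A ω' \ W lies inside the fragment, and A ω' competes in the minimum defining it, so the two
coincide. -/
theorem fragment_subset_of_subset_union (A : Ω → Finset V) (W : Finset V) {ω ω' : Ω}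
    (h : A ω' ⊆ fragment A W ω ∪ W) (hc : (A ω').card ≤ (A ω).card) :
    fragment A W ω ⊆ A ω' := by
  have h1 : A ω' \ W ⊆ fragment A W ω := by
    intro x hx
    rw [mem_sdiff] at hx
    have := h hx.1
    rw [mem_union] at this
    tauto
  have h2 : A ω' ⊆ W ∪ A ω := by
    rw [union_comm]
    exact h.trans (union_subset_union_left (fragment_subset A W ω))
  rw [← eq_of_subset_of_card_le h1 (card_fragment_le A W h2 hc)]
  exact sdiff_subset

/-- The coloring that agrees with `c` off `T` and is constant equal to `a` on `T`. -/
def recolor {κ : Type*} (c : V → κ) (T : Finset V) (a : κ) : V → κ :=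
  fun x => if x ∈ T then a else c x

/-- Successive fragments along the sets `W 0, …, W (l - 1)`. -/
noncomputable def iterFragment (A : Ω → Finset V) (W : ℕ → Finset V) : ℕ → Ω → Finset V
  | 0 => A
  | l + 1 => fragment (iterFragment A W l) (W l)

theorem iterFragment_congr (A : Ω → Finset V) {W W' : ℕ → Finset V} (l : ℕ)
    (h : ∀ j < l, W j = W' j) : iterFragment A W l = iterFragment A W' l := by
  induction l with
  | zero => rfl
  | succ l ih =>
    rw [iterFragment, iterFragment, ih (fun j hj => h j (by omega)), h l (by omega)]

theorem iterFragment_subset (A : Ω → Finset V) (W : ℕ → Finset V) (l : ℕ) (ω : Ω) :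
    iterFragment A W l ω ⊆ A ω := by
  induction l with
  | zero => exact Subset.rfl
  | succ l ih => exact (fragment_subset _ _ _).trans ih

theorem disjoint_iterFragment (A : Ω → Finset V) (W : ℕ → Finset V) {j l : ℕ} (hj : j < l)
    (ω : Ω) : Disjoint (iterFragment A W l ω) (W j) := by
  induction l with
  | zero => omega
  | succ l ih =>
    rcases Nat.lt_succ_iff_lt_or_eq.1 hj with h | h
    · exact (ih h).mono_left (fragment_subset _ _ _)
    · rw [h]; exact disjoint_fragment _ _ _

theorem exists_subset_iterFragment_union (A : Ω → Finset V) (W : ℕ → Finset V) (l : ℕ) (ω : Ω) :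
    ∃ ω', A ω' ⊆ iterFragment A W l ω ∪ (range l).biUnion W := by
  induction l generalizing ω with
  | zero => exact ⟨ω, subset_union_left⟩
  | succ l ih =>
    obtain ⟨ω₁, h1, -⟩ := exists_subset_fragment_union (iterFragment A W l) (W l) ω
    obtain ⟨ω₂, h2⟩ := ih ω₁
    refine ⟨ω₂, fun x hx => ?_⟩
    have h3 := h2 hx
    rw [range_add_one, biUnion_insert]
    rw [mem_union] at h3 ⊢
    rw [mem_union]
    rcases h3 with h3 | h3
    · have := h1 h3
      rw [mem_union] at this
      rcases this with h | h
      · exact Or.inl h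
      · exact Or.inr (Or.inl h)
    · exact Or.inr (Or.inr h3)

variable [Fintype V] {κ : Type*} [DecidableEq κ]

theorem card_recolor_eq_le [Fintype κ] (c' : V → κ) (T : Finset V) (a : κ) :
    (univ.filter (fun c : V → κ => recolor c T a = c')).card ≤ Fintype.card κ ^ T.card := by
  have h := card_le_card_of_injOn (s := univ.filter (fun c : V → κ => recolor c T a = c'))
    (t := (univ : Finset (T → κ))) (fun c x => c x) (fun _ _ => mem_coe.2 (mem_univ _)) (by
      intro c hc d hd hcd
      simp only [coe_filter, mem_univ, true_and, Set.mem_ofPred_eq] at hc hd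
      funext x
      by_cases hx : x ∈ T
      · exact congrFun hcd ⟨x, hx⟩
      · have := congrFun (hc.trans hd.symm) x
        simpa [recolor, hx] using this)
  simpa using h

/-- The color class of `a`. -/
def colorClass (c : V → κ) (a : κ) : Finset V := univ.filter (fun x => c x = a)

theorem mem_colorClass {V : Type*} [Fintype V] {c : V → κ} {a : κ} {x : V} : x ∈ colorClass c a ↔ c x = a := by
  rw [colorClass, mem_filter, and_iff_right (mem_univ _)]

theorem colorClass_recolor (c : V → κ) (T : Finset V) (a : κ) :
    colorClass (recolor c T a) a = T ∪ colorClass c a := by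
  ext x
  by_cases hx : x ∈ T <;> simp [colorClass, recolor, hx]

variable [Fintype Ω] [Fintype κ]

/-- An encoding argument for fragments T larger than a quarter of their set. Recolouring T by a
gives c', which determines A and the union of T with the old class. The smallest member S inside
that union contains T, and |S| < 4|T|, so T is one of few subsets of S. Given T, there are at most
|κ|^|T| colourings c and at most |Ω|/R^|T| indices ω. -/
theorem sum_card_fragment_fiber_le (A : (V → κ) → Ω → Finset V) (a : κ) {R : ℝ} (hR : 0 < R)
    (hκ : 2 ^ 11 * (Fintype.card κ : ℝ) ≤ R)
    (hspread : ∀ c Z, ((univ.filter (fun ω => Z ⊆ A c ω)).card : ℝ) * R ^ Z.card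
      ≤ Fintype.card Ω)
    (hinv : ∀ c ω T, T ⊆ A c ω → A (recolor c T a) = A c) (c' : V → κ) :
    ∑ p ∈ (univ : Finset ((V → κ) × Ω)).filter (fun p =>
        (A p.1 p.2).card < 4 * (fragment (A p.1) (colorClass p.1 a) p.2).card ∧
        recolor p.1 (fragment (A p.1) (colorClass p.1 a) p.2) a = c'),
      ((fragment (A p.1) (colorClass p.1 a) p.2).card : ℝ)
      ≤ 1 / 4 * ∑ ω, ((A c' ω).card : ℝ) := by
  set T : (V → κ) × Ω → Finset V := fun p => fragment (A p.1) (colorClass p.1 a) p.2 with hTdef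
  set P := (univ : Finset ((V → κ) × Ω)).filter (fun p =>
        (A p.1 p.2).card < 4 * (T p).card ∧ recolor p.1 (T p) a = c') with hP
  have hmem : ∀ p ∈ P, (A p.1 p.2).card < 4 * (T p).card ∧ recolor p.1 (T p) a = c' :=
    fun p hp => by rw [hP, mem_filter] at hp; exact hp.2
  have hA : ∀ p ∈ P, A p.1 = A c' := by
    intro p hp
    rw [← (hmem p hp).2, hinv p.1 p.2 _ (fragment_subset _ _ _)]
  have hclass : ∀ p ∈ P, colorClass c' a = T p ∪ colorClass p.1 a := by
    intro p hp
    rw [← (hmem p hp).2, colorClass_recolor]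
  rcases P.eq_empty_or_nonempty with hPe | ⟨p₀, hp₀⟩
  · rw [hPe, sum_empty]
    exact mul_nonneg (by norm_num) (sum_nonneg (fun ω _ => Nat.cast_nonneg _))
  -- An empty member would make every fragment empty, hence not large. Nonemptiness later bounds |Ω|
  -- by the total size of the members.
  have hne : ∀ ω, 1 ≤ (A c' ω).card := by
    intro ω
    by_contra hcon
    have h0 : A c' ω = ∅ := by
      rw [← card_eq_zero]; omega
    have h1 := card_fragment_le (A p₀.1) (colorClass p₀.1 a) (ω := p₀.2) (ω' := ω)
      (by rw [hA p₀ hp₀, h0]; exact empty_subset _) (by rw [hA p₀ hp₀, h0]; simp)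
    rw [hA p₀ hp₀, h0] at h1
    have h2 := (hmem p₀ hp₀).1
    simp only [hTdef] at h2
    rw [hA p₀ hp₀] at h2
    simp at h1
    simp [h1] at h2
  -- the smallest member inside the color class
  have hex : ((univ : Finset Ω).filter (fun ω => A c' ω ⊆ colorClass c' a)).Nonempty := by
    obtain ⟨ω', h1, -⟩ := exists_subset_fragment_union (A p₀.1) (colorClass p₀.1 a) p₀.2
    refine ⟨ω', mem_filter.2 ⟨mem_univ _, ?_⟩⟩
    rw [hclass p₀ hp₀, ← hA p₀ hp₀]
    exact h1
  obtain ⟨ω₁, hω₁, hmin⟩ := exists_min_image _ (fun ω => (A c' ω).card) hex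
  have hω₁' := (mem_filter.1 hω₁).2
  set S := A c' ω₁ with hS
  have hTS : ∀ p ∈ P, T p ∈ S.powerset.filter (fun U => S.card < 4 * U.card) := by
    intro p hp
    obtain ⟨ω', h1, h2⟩ := exists_subset_fragment_union (A p.1) (colorClass p.1 a) p.2
    have h3 : ω' ∈ (univ : Finset Ω).filter (fun ω => A c' ω ⊆ colorClass c' a) := by
      refine mem_filter.2 ⟨mem_univ _, ?_⟩
      rw [hclass p hp, ← hA p hp]
      exact h1
    have h4 : S.card ≤ (A p.1 p.2).card := by
      refine (hmin ω' h3).trans ?_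
      rw [← hA p hp]; exact h2
    rw [mem_filter, mem_powerset]
    refine ⟨?_, h4.trans_lt (hmem p hp).1⟩
    have hAS : A p.1 ω₁ = S := by rw [hA p hp]
    have h5 := fragment_subset_of_subset_union (A p.1) (colorClass p.1 a) (ω := p.2) (ω' := ω₁)
      (by rw [hAS]; rw [hclass p hp] at hω₁'; exact hω₁') (by rw [hAS]; exact h4)
    rw [hAS] at h5
    exact h5
  have hfib : ∀ U ∈ S.powerset.filter (fun U => S.card < 4 * U.card),
      ∑ p ∈ P.filter (fun p => T p = U), ((T p).card : ℝ)
        ≤ Fintype.card Ω * ((U.card : ℝ) * ((Fintype.card κ : ℝ) / R) ^ U.card) := by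
    intro U _
    have h1 : P.filter (fun p => T p = U) ⊆
        (univ.filter (fun c : V → κ => recolor c U a = c')) ×ˢ
          (univ.filter (fun ω => U ⊆ A c' ω)) := by
      intro p hp
      rw [mem_filter] at hp
      rw [mem_product, mem_filter, mem_filter]
      refine ⟨⟨mem_univ _, ?_⟩, mem_univ _, ?_⟩
      · rw [← hp.2]; exact (hmem p hp.1).2
      · rw [← hp.2, ← hA p hp.1]; exact fragment_subset _ _ _
    have h2 : ((P.filter (fun p => T p = U)).card : ℝ) ≤
        (Fintype.card κ : ℝ) ^ U.card * (univ.filter (fun ω => U ⊆ A c' ω)).card := by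
      have := (card_le_card h1)
      rw [card_product] at this
      have h3 := this.trans (Nat.mul_le_mul_right _ (card_recolor_eq_le c' U a))
      exact_mod_cast h3
    have h3 : ((univ.filter (fun ω => U ⊆ A c' ω)).card : ℝ) ≤ Fintype.card Ω / R ^ U.card := by
      rw [le_div_iff₀ (by positivity)]; exact hspread c' U
    calc ∑ p ∈ P.filter (fun p => T p = U), ((T p).card : ℝ)
        = ∑ p ∈ P.filter (fun p => T p = U), (U.card : ℝ) :=
          sum_congr rfl (fun p hp => by rw [(mem_filter.1 hp).2])
      _ = (P.filter (fun p => T p = U)).card * (U.card : ℝ) := by rw [sum_const, nsmul_eq_mul]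
      _ ≤ ((Fintype.card κ : ℝ) ^ U.card * (Fintype.card Ω / R ^ U.card)) * U.card := by
          gcongr
          exact h2.trans (by gcongr)
      _ = _ := by rw [div_pow]; ring
  calc ∑ p ∈ P, ((T p).card : ℝ)
      = ∑ U ∈ S.powerset.filter (fun U => S.card < 4 * U.card),
          ∑ p ∈ P.filter (fun p => T p = U), ((T p).card : ℝ) :=
        (sum_fiberwise_of_maps_to hTS _).symm
    _ ≤ ∑ U ∈ S.powerset.filter (fun U => S.card < 4 * U.card),
          Fintype.card Ω * ((U.card : ℝ) * ((Fintype.card κ : ℝ) / R) ^ U.card) :=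
        sum_le_sum hfib
    _ ≤ Fintype.card Ω * (1 / 4) := by
        rw [← mul_sum]
        gcongr
        exact sum_large_subsets_le S (by positivity) hR hκ
    _ ≤ 1 / 4 * ∑ ω, ((A c' ω).card : ℝ) := by
        rw [mul_comm]
        gcongr
        calc (Fintype.card Ω : ℝ) = ∑ _ω : Ω, (1 : ℝ) := by simp
          _ ≤ _ := sum_le_sum (fun ω _ => by exact_mod_cast hne ω)

/-- Fragments of at most a quarter of their set contribute at most 1/4 of the total; the larger ones
contribute another 1/4 after grouping by the recoloured colouring. -/
theorem sum_card_fragment_le (A : (V → κ) → Ω → Finset V) (a : κ) {R : ℝ} (hR : 0 < R)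
    (hκ : 2 ^ 11 * (Fintype.card κ : ℝ) ≤ R)
    (hspread : ∀ c Z, ((univ.filter (fun ω => Z ⊆ A c ω)).card : ℝ) * R ^ Z.card
      ≤ Fintype.card Ω)
    (hinv : ∀ c ω T, T ⊆ A c ω → A (recolor c T a) = A c) :
    ∑ c, ∑ ω, ((fragment (A c) (colorClass c a) ω).card : ℝ)
      ≤ 1 / 2 * ∑ c, ∑ ω, ((A c ω).card : ℝ) := by
  classical
  set T : (V → κ) × Ω → Finset V := fun p => fragment (A p.1) (colorClass p.1 a) p.2 with hTdef
  set Q := (univ : Finset ((V → κ) × Ω)).filter (fun p => (A p.1 p.2).card < 4 * (T p).card)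
    with hQ
  have h1 : ∑ p ∈ Q, ((T p).card : ℝ) ≤ 1 / 4 * ∑ c, ∑ ω, ((A c ω).card : ℝ) := by
    rw [← sum_fiberwise_of_maps_to (s := Q) (t := univ)
      (g := fun p => recolor p.1 (T p) a) (fun _ _ => mem_univ _), mul_sum]
    refine sum_le_sum (fun c' _ => ?_)
    rw [hQ, filter_filter]
    exact sum_card_fragment_fiber_le A a hR hκ hspread hinv c'
  have h2 : ∑ p, ((T p).card : ℝ) ≤
      1 / 4 * ∑ p : (V → κ) × Ω, ((A p.1 p.2).card : ℝ) + ∑ p ∈ Q, ((T p).card : ℝ) := by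
    rw [hQ, sum_filter, mul_sum, ← sum_add_distrib]
    refine sum_le_sum (fun p _ => ?_)
    split_ifs with h
    · have : (0 : ℝ) ≤ (A p.1 p.2).card := by positivity
      linarith
    · have : (4 : ℝ) * (T p).card ≤ (A p.1 p.2).card := by exact_mod_cast not_lt.1 h
      linarith
  rw [Fintype.sum_prod_type, Fintype.sum_prod_type] at h2
  simp only [hTdef] at h1 h2
  linarith

/-- One halving per exposed colour. The current fragments avoid the classes already exposed, so
recolouring part of one with a new colour leaves those classes, and hence the fragments, unchanged.
-/
theorem sum_card_iterFragment_le (A : Ω → Finset V) (a : ℕ → κ) {R : ℝ} (hR : 0 < R)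
    (hκ : 2 ^ 11 * (Fintype.card κ : ℝ) ≤ R)
    (hspread : ∀ Z, ((univ.filter (fun ω => Z ⊆ A ω)).card : ℝ) * R ^ Z.card ≤ Fintype.card Ω)
    (m : ℕ) (ha : ∀ i j, i < j → j < m → a i ≠ a j) :
    ∑ c : V → κ, ∑ ω, ((iterFragment A (fun j => colorClass c (a j)) m ω).card : ℝ)
      ≤ (1 / 2) ^ m * (Fintype.card (V → κ) * ∑ ω, ((A ω).card : ℝ)) := by
  induction m with
  | zero =>
    simp only [iterFragment, sum_const, card_univ, nsmul_eq_mul, pow_zero, one_mul]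
    exact le_rfl
  | succ m ih =>
    have h1 := sum_card_fragment_le
      (fun c : V → κ => iterFragment A (fun j => colorClass c (a j)) m) (a m) hR hκ ?_ ?_
    · have h2 := ih (fun i j hij hj => ha i j hij (by omega))
      calc _ ≤ _ := h1
        _ ≤ 1 / 2 * ((1 / 2) ^ m * (Fintype.card (V → κ) * ∑ ω, ((A ω).card : ℝ))) := by
            gcongr
        _ = _ := by ring
    · intro c Z
      refine le_trans (mul_le_mul_of_nonneg_right (Nat.cast_le.2 (card_le_card (fun ω hω => ?_)))
        (by positivity)) (hspread Z)
      rw [mem_filter] at hω ⊢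
      exact ⟨hω.1, hω.2.trans (iterFragment_subset _ _ _ _)⟩
    · intro c ω T hT
      refine iterFragment_congr A m (fun j hj => ?_)
      ext x
      by_cases hx : x ∈ T
      · have h2 := disjoint_left.1 (disjoint_iterFragment A (fun j => colorClass c (a j)) hj ω)
          (hT hx)
        have h3 := (ha j m hj (by omega)).symm
        rw [mem_colorClass] at h2 ⊢
        simp only [mem_colorClass, recolor, if_pos hx, h2, h3]
      · simp only [mem_colorClass, recolor, if_neg hx]

/-- Markov's inequality: for a bad colouring no final fragment is empty, so it contributes at least
|Ω| to the total fragment size. -/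
theorem card_not_subset_colorClasses_le [Nonempty Ω] (A : Ω → Finset V) (a : ℕ → κ) {R : ℝ}
    (hR : 0 < R) (hκ : 2 ^ 11 * (Fintype.card κ : ℝ) ≤ R)
    (hspread : ∀ Z, ((univ.filter (fun ω => Z ⊆ A ω)).card : ℝ) * R ^ Z.card ≤ Fintype.card Ω)
    (m : ℕ) (ha : ∀ i j, i < j → j < m → a i ≠ a j) {k : ℕ} (hk : ∀ ω, (A ω).card ≤ k) :
    ((univ.filter (fun c : V → κ =>
      ∀ ω, ¬ A ω ⊆ (range m).biUnion (fun j => colorClass c (a j)))).card : ℝ)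
      ≤ (1 / 2) ^ m * (Fintype.card (V → κ) * k) := by
  set B := univ.filter (fun c : V → κ =>
      ∀ ω, ¬ A ω ⊆ (range m).biUnion (fun j => colorClass c (a j))) with hB
  have hΩ : (0 : ℝ) < Fintype.card Ω := by exact_mod_cast Fintype.card_pos
  have h1 : (B.card : ℝ) * Fintype.card Ω ≤
      ∑ c : V → κ, ∑ ω, ((iterFragment A (fun j => colorClass c (a j)) m ω).card : ℝ) := by
    calc (B.card : ℝ) * Fintype.card Ω = ∑ c ∈ B, ∑ _ω : Ω, (1 : ℝ) := by simp
      _ ≤ ∑ c ∈ B, ∑ ω, ((iterFragment A (fun j => colorClass c (a j)) m ω).card : ℝ) := by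
          refine sum_le_sum (fun c hc => sum_le_sum (fun ω _ => ?_))
          rw [hB, mem_filter] at hc
          obtain ⟨ω', h⟩ := exists_subset_iterFragment_union A (fun j => colorClass c (a j)) m ω
          by_contra hlt
          have h0 : iterFragment A (fun j => colorClass c (a j)) m ω = ∅ := by
            rw [← card_eq_zero]
            by_contra hne
            exact hlt (by exact_mod_cast Nat.one_le_iff_ne_zero.2 hne)
          rw [h0, empty_union] at h
          exact hc.2 ω' h
      _ ≤ _ := sum_le_sum_of_subset_of_nonneg (subset_univ _)
          (fun c _ _ => sum_nonneg (fun ω _ => Nat.cast_nonneg _))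
  have h2 := h1.trans (sum_card_iterFragment_le A a hR hκ hspread m ha)
  have h3 : ∑ ω, ((A ω).card : ℝ) ≤ Fintype.card Ω * k := by
    calc ∑ ω, ((A ω).card : ℝ) ≤ ∑ _ω : Ω, (k : ℝ) :=
          sum_le_sum (fun ω _ => by exact_mod_cast hk ω)
      _ = _ := by simp
  refine le_of_mul_le_mul_right (h2.trans ?_) hΩ
  calc (1 / 2) ^ m * (Fintype.card (V → κ) * ∑ ω, ((A ω).card : ℝ))
      ≤ (1 / 2) ^ m * (Fintype.card (V → κ) * (Fintype.card Ω * k)) := by gcongr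
    _ = _ := by ring

end Spread

/-- Spread families with one member each that are pairwise disjoint. -/
theorem exists_pairwise_disjoint_of_spread {V ι : Type*} [DecidableEq V] [Fintype V]
    [DecidableEq ι] [Fintype ι] [Nonempty ι] {Ω : ι → Type*} [∀ i, Fintype (Ω i)]
    [∀ i, Nonempty (Ω i)] (A : ∀ i, Ω i → Finset V) {k m : ℕ} {R : ℝ}
    (hR : 2 ^ 11 * ((Fintype.card ι : ℝ) * (m + 1)) ≤ R) (hk : ∀ i ω, (A i ω).card ≤ k)
    (hspread : ∀ i Z, ((univ.filter (fun ω => Z ⊆ A i ω)).card : ℝ) * R ^ Z.card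
      ≤ Fintype.card (Ω i))
    (hm : Fintype.card ι * k < 2 ^ (m + 1)) :
    ∃ ω : ∀ i, Ω i, ∀ i j, i ≠ j → Disjoint (A i (ω i)) (A j (ω j)) := by
  -- Each index owns m + 1 private colours, so members covered by the colours of different indices
  -- are disjoint. A union bound over indices yields a colouring good for all of them.
  let a : ι → ℕ → ι × Fin (m + 1) := fun i j => (i, Fin.ofNat (m + 1) j)
  have hι : (0 : ℝ) < Fintype.card ι := by exact_mod_cast Fintype.card_pos
  have hR0 : 0 < R := lt_of_lt_of_le (by positivity) hR
  let B : ι → Finset (V → ι × Fin (m + 1)) := fun i => univ.filter (fun c =>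
      ∀ ω, ¬ A i ω ⊆ (range (m + 1)).biUnion (fun j => colorClass c (a i j)))
  have hB : ∀ i, ((B i).card : ℝ) ≤
      (1 / 2) ^ (m + 1) * (Fintype.card (V → ι × Fin (m + 1)) * k) := by
    intro i
    refine card_not_subset_colorClasses_le (A i) (a i) hR0 ?_ (hspread i) (m + 1) ?_ (hk i)
    · simpa using hR
    · intro j j' hjj hj' h
      have h1 := congrArg (fun p => (p.2 : ℕ)) h
      simp only [a, Fin.ofNat, Nat.mod_eq_of_lt hj', Nat.mod_eq_of_lt (hjj.trans hj')] at h1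
      omega
  have hN : (0 : ℝ) < Fintype.card (V → ι × Fin (m + 1)) := by
    exact_mod_cast Fintype.card_pos
  have hU : ((univ.biUnion B).card : ℝ) < Fintype.card (V → ι × Fin (m + 1)) := by
    calc ((univ.biUnion B).card : ℝ) ≤ ∑ i, ((B i).card : ℝ) := by
          exact_mod_cast card_biUnion_le
      _ ≤ ∑ _i : ι, (1 / 2) ^ (m + 1) * (Fintype.card (V → ι × Fin (m + 1)) * (k : ℝ)) :=
          sum_le_sum (fun i _ => hB i)
      _ = (1 / 2) ^ (m + 1) * (Fintype.card ι * k) * Fintype.card (V → ι × Fin (m + 1)) := by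
          rw [sum_const, card_univ, nsmul_eq_mul]; ring
      _ < 1 * Fintype.card (V → ι × Fin (m + 1)) := by
          refine mul_lt_mul_of_pos_right ?_ hN
          rw [one_div, inv_pow, inv_mul_lt_iff₀ (by positivity), mul_one]
          exact_mod_cast hm
      _ = _ := one_mul _
  obtain ⟨c, hc⟩ : ∃ c, c ∉ univ.biUnion B := by
    by_contra! hcon
    rw [eq_univ_iff_forall.2 hcon, card_univ] at hU
    exact lt_irrefl _ hU
  have h1 : ∀ i, ∃ ω, A i ω ⊆ (range (m + 1)).biUnion (fun j => colorClass c (a i j)) := by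
    intro i
    by_contra! hcon
    exact hc (mem_biUnion.2 ⟨i, mem_univ _, mem_filter.2 ⟨mem_univ _, hcon⟩⟩)
  choose ω hω using h1
  have h2 : ∀ i, ∀ x ∈ A i (ω i), (c x).1 = i := by
    intro i x hx
    obtain ⟨j, -, hj⟩ := mem_biUnion.1 (hω i hx)
    rw [colorClass, mem_filter] at hj
    rw [hj.2]
  refine ⟨ω, fun i j hij => disjoint_left.2 (fun x hx hx' => hij ?_)⟩
  rw [← h2 i x hx, h2 j x hx']

theorem choose_mul_pow_le (N b : ℕ) : (N.choose b : ℝ) * (b : ℝ) ^ b ≤ (3 * N : ℝ) ^ b := by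
  have h1 : (N.choose b : ℝ) ≤ (N : ℝ) ^ b / (b.factorial : ℝ) := Nat.choose_le_pow_div b N
  have h2 : (b : ℝ) ^ b / (b.factorial : ℝ) ≤ 3 ^ b := by
    refine (Real.pow_div_factorial_le_exp (b : ℝ) (by positivity) b).trans ?_
    rw [← mul_one (b : ℝ), Real.exp_nat_mul]
    gcongr
    exact Real.exp_one_lt_d9.le.trans (by norm_num)
  calc (N.choose b : ℝ) * (b : ℝ) ^ b ≤ (N : ℝ) ^ b / (b.factorial : ℝ) * (b : ℝ) ^ b := by gcongr
    _ = (N : ℝ) ^ b * ((b : ℝ) ^ b / (b.factorial : ℝ)) := by ring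
    _ ≤ (N : ℝ) ^ b * 3 ^ b := by gcongr
    _ = _ := by rw [mul_pow]; ring

/-! ### Cores and the intersections they must have -/

section Cores

variable {V : Type*} [DecidableEq V]

/-- `H` is a nonempty family of sets containing `X`, and it is `τ`-spread outside `X`. -/
def SpreadOver (τ : ℝ) (H : Finset (Finset V)) (X : Finset V) : Prop :=
  H.Nonempty ∧ (∀ F ∈ H, X ⊆ F) ∧
    ∀ Z, Disjoint Z X → ((H.filter (fun F => Z ⊆ F)).card : ℝ) * τ ^ Z.card ≤ H.card

/-- Some subfamily of `R` is `τ`-spread over `X`. -/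
def IsCore (τ : ℝ) (R : Finset (Finset V)) (X : Finset V) : Prop :=
  ∃ H ⊆ R, SpreadOver τ H X

theorem IsCore.mono {τ : ℝ} {R R' : Finset (Finset V)} {X : Finset V} (h : IsCore τ R X)
    (hR : R ⊆ R') : IsCore τ R' X := by
  obtain ⟨H, h1, h2⟩ := h
  exact ⟨H, h1.trans hR, h2⟩

theorem mem_containing {F : Finset (Finset V)} {X A : Finset V} :
    A ∈ containing F X ↔ A ∈ F ∧ X ⊆ A := mem_filter

theorem mem_containingSome {F S : Finset (Finset V)} {A : Finset V} :
    A ∈ containingSome F S ↔ A ∈ F ∧ ∃ X ∈ S, X ⊆ A := by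
  simp only [containingSome, mem_biUnion, mem_containing]
  tauto

theorem IsCore.exists_subset {τ : ℝ} {R : Finset (Finset V)} {X : Finset V}
    (h : IsCore τ R X) : ∃ F ∈ R, X ⊆ F := by
  obtain ⟨H, h1, ⟨F, hF⟩, h2, -⟩ := h
  exact ⟨F, h1 hF, h2 F hF⟩

/-- Take X ⊇ Y maximizing |G[X]| τ^|X|; maximality against Z ∪ X is exactly spreadness of G[X] over
X. -/
theorem exists_isCore_superset [Fintype V] {τ : ℝ} (hτ : 0 < τ) (G : Finset (Finset V))
    (Y : Finset V) (hY : (containing G Y).Nonempty) :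
    ∃ X, Y ⊆ X ∧ IsCore τ G X ∧
      ((containing G Y).card : ℝ) * τ ^ Y.card ≤ (containing G X).card * τ ^ X.card := by
  obtain ⟨X, hX, hmax⟩ := exists_max_image (univ.filter (fun X => Y ⊆ X))
    (fun X => ((containing G X).card : ℝ) * τ ^ X.card)
    ⟨Y, mem_filter.2 ⟨mem_univ _, Subset.rfl⟩⟩
  have hYX := (mem_filter.1 hX).2
  have h1 := hmax Y (mem_filter.2 ⟨mem_univ _, Subset.rfl⟩)
  refine ⟨X, hYX, ⟨containing G X, filter_subset _ _, ?_, ?_, ?_⟩, h1⟩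
  · rw [nonempty_iff_ne_empty]
    intro h0
    have h2 : (0 : ℝ) < (containing G Y).card := by exact_mod_cast hY.card_pos
    have h3 : (0 : ℝ) < (containing G Y).card * τ ^ Y.card := by positivity
    simp only [h0, card_empty, Nat.cast_zero, zero_mul] at h1
    linarith
  · exact fun F hF => (mem_containing.1 hF).2
  · intro Z hZ
    have h2 := hmax (Z ∪ X) (mem_filter.2 ⟨mem_univ _, hYX.trans subset_union_right⟩)
    have h3 : (containing G X).filter (fun F => Z ⊆ F) = containing G (Z ∪ X) := by
      ext F
      simp only [mem_filter, mem_containing, union_subset_iff]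
      tauto
    rw [card_union_of_disjoint hZ, pow_add, ← mul_assoc] at h2
    rw [h3]
    exact le_of_mul_le_mul_right h2 (by positivity)

/-- A union bound over the b-subsets of Q gives proportion at most (3|Q|/(bτ))^b ≤ x^b ≤ x. -/
theorem SpreadOver.card_filter_card_inter_le {τ : ℝ} (hτ : 0 < τ) {H : Finset (Finset V)}
    {X Q : Finset V} (h : SpreadOver τ H X) (hQ : Disjoint Q X) {b : ℕ} (hb : 1 ≤ b) {x : ℝ}
    (hx0 : 0 ≤ x) (hx1 : x ≤ 1) (hx : 3 * (Q.card : ℝ) ≤ x * (b * τ)) :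
    ((H.filter (fun F => b ≤ (F ∩ Q).card)).card : ℝ) ≤ x * H.card := by
  have h1 : H.filter (fun F => b ≤ (F ∩ Q).card) ⊆
      (Q.powersetCard b).biUnion (fun Z => H.filter (fun F => Z ⊆ F)) := by
    intro F hF
    rw [mem_filter] at hF
    obtain ⟨Z, hZ, hZb⟩ := exists_subset_card_eq hF.2
    rw [mem_biUnion]
    exact ⟨Z, mem_powersetCard.2 ⟨hZ.trans inter_subset_right, hZb⟩,
      mem_filter.2 ⟨hF.1, hZ.trans inter_subset_left⟩⟩
  have hb0 : (0 : ℝ) < b := by exact_mod_cast hb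
  have h2 : ((H.filter (fun F => b ≤ (F ∩ Q).card)).card : ℝ) * τ ^ b ≤
      Q.card.choose b * H.card := by
    calc ((H.filter (fun F => b ≤ (F ∩ Q).card)).card : ℝ) * τ ^ b
        ≤ (∑ Z ∈ Q.powersetCard b, ((H.filter (fun F => Z ⊆ F)).card : ℝ)) * τ ^ b := by
          gcongr
          exact_mod_cast (card_le_card h1).trans card_biUnion_le
      _ = ∑ Z ∈ Q.powersetCard b, ((H.filter (fun F => Z ⊆ F)).card : ℝ) * τ ^ b := by
          rw [sum_mul]
      _ ≤ ∑ Z ∈ Q.powersetCard b, (H.card : ℝ) := by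
          refine sum_le_sum (fun Z hZ => ?_)
          rw [mem_powersetCard] at hZ
          rw [← hZ.2]
          exact h.2.2 Z (hQ.mono_left hZ.1)
      _ = _ := by rw [sum_const, card_powersetCard, nsmul_eq_mul]
  have h3 : ((H.filter (fun F => b ≤ (F ∩ Q).card)).card : ℝ) * (b * τ) ^ b ≤
      (x ^ b * H.card) * (b * τ) ^ b := by
    calc ((H.filter (fun F => b ≤ (F ∩ Q).card)).card : ℝ) * (b * τ) ^ b
        = ((H.filter (fun F => b ≤ (F ∩ Q).card)).card : ℝ) * τ ^ b * b ^ b := by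
          rw [mul_pow]; ring
      _ ≤ (Q.card.choose b * H.card) * b ^ b := by gcongr
      _ = (Q.card.choose b * (b : ℝ) ^ b) * H.card := by ring
      _ ≤ (3 * Q.card : ℝ) ^ b * H.card := by
          gcongr
          exact choose_mul_pow_le _ _
      _ ≤ (x * (b * τ)) ^ b * H.card := by gcongr
      _ = _ := by rw [mul_pow x]; ring
  refine (le_of_mul_le_mul_right h3 (by positivity)).trans ?_
  gcongr
  exact pow_le_of_le_one hx0 hx1 (by omega)

/-- Cores of a family with small matching number cannot have pairwise small intersections. -/
theorem exists_lt_card_inter_add_of_isCore [Fintype V] {R : Finset (Finset V)} {s t k m d e : ℕ}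
    {τ : ℝ}
    (hν : ∀ A : Fin (s + 1) → Finset V, (∀ i, A i ∈ R) → ∃ i j, i < j ∧ t ≤ (A i ∩ A j).card)
    (hk : ∀ F ∈ R, F.card ≤ k) (he : 1 ≤ e)
    (hτ1 : 2 ^ 12 * (((s : ℝ) + 1) * (m + 1)) ≤ τ) (hm : (s + 1) * k < 2 ^ (m + 1))
    (hτ2 : 12 * ((s : ℝ) + 1) * ((d : ℝ) / e + 1) ≤ τ)
    (X : Fin (s + 1) → Finset V) (hX : ∀ i, IsCore τ R (X i)) (hXd : ∀ i, (X i).card ≤ t + d) :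
    ∃ i j, i < j ∧ t < (X i ∩ X j).card + e := by
  by_contra! hcon
  have hsep : ∀ i j, i ≠ j → (X i ∩ X j).card + e ≤ t := by
    intro i j hij
    rcases lt_or_gt_of_ne hij with h | h
    · exact hcon i j h
    · rw [inter_comm]; exact hcon j i h
  have hτ : 0 < τ := lt_of_lt_of_le (by positivity) hτ1
  have he0 : (0 : ℝ) < e := by exact_mod_cast he
  choose H hHR hH using hX
  -- Half of the deficit t - |X i ∩ X j|, rounded up: two overlaps each strictly below it add up to
  -- less than the deficit, so the chosen members still meet in fewer than t points.
  let b : Fin (s + 1) → Fin (s + 1) → ℕ := fun i j => (t - (X i ∩ X j).card + 1) / 2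
  let bad : Fin (s + 1) → Fin (s + 1) → Finset (Finset V) := fun i j =>
    (H i).filter (fun F => b i j ≤ (F ∩ (X j \ X i)).card)
  have hbad : ∀ i j, i ≠ j → ((bad i j).card : ℝ) ≤ 1 / (2 * ((s : ℝ) + 1)) * (H i).card := by
    intro i j hij
    have h1 := hsep i j hij
    refine (hH i).card_filter_card_inter_le hτ sdiff_disjoint (b := b i j)
      (by simp only [b]; omega) (by positivity) ?_ ?_
    · rw [div_le_one (by positivity)]
      have : (0 : ℝ) ≤ s := by positivity
      linarith
    · have h2 : (X j \ X i).card + (X i ∩ X j).card = (X j).card := by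
        rw [inter_comm]; exact card_sdiff_add_card_inter _ _
      have h3 := hXd j
      have h4 : (X j \ X i).card ≤ d + (t - (X i ∩ X j).card) := by omega
      set g := t - (X i ∩ X j).card with hg
      have hge : e ≤ g := by omega
      have h5 : (g : ℝ) ≤ 2 * b i j := by
        have : g ≤ 2 * b i j := by simp only [b]; omega
        exact_mod_cast this
      have h6 : ((X j \ X i).card : ℝ) ≤ d + g := by exact_mod_cast h4
      have h7 : (d : ℝ) + g ≤ (d / e + 1) * g := by
        have : (d : ℝ) ≤ d / e * g := by
          rw [div_mul_eq_mul_div, le_div_iff₀ he0]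
          gcongr
        linarith
      have h8 : (0 : ℝ) ≤ d / e + 1 := by positivity
      have h9 : 6 * ((d : ℝ) / e + 1) ≤ 1 / (2 * ((s : ℝ) + 1)) * τ := by
        rw [one_div, ← div_eq_inv_mul, le_div_iff₀ (by positivity)]
        linarith
      calc 3 * ((X j \ X i).card : ℝ) ≤ 3 * ((d / e + 1) * (2 * b i j)) := by
            gcongr
            exact h6.trans (h7.trans (by gcongr))
        _ = (6 * ((d : ℝ) / e + 1)) * b i j := by ring
        _ ≤ (1 / (2 * ((s : ℝ) + 1)) * τ) * b i j := by gcongr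
        _ = _ := by ring
  let K : Fin (s + 1) → Finset (Finset V) := fun i =>
    H i \ (univ.filter (fun j => i ≠ j)).biUnion (bad i)
  have hK : ∀ i, ((H i).card : ℝ) ≤ 2 * (K i).card := by
    intro i
    have h1 : (((univ.filter (fun j => i ≠ j)).biUnion (bad i)).card : ℝ) ≤
        1 / 2 * (H i).card := by
      calc (((univ.filter (fun j => i ≠ j)).biUnion (bad i)).card : ℝ)
          ≤ ∑ j ∈ univ.filter (fun j => i ≠ j), ((bad i j).card : ℝ) := by
            exact_mod_cast card_biUnion_le
        _ ≤ ∑ j ∈ univ.filter (fun j => i ≠ j),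
              1 / (2 * ((s : ℝ) + 1)) * ((H i).card : ℝ) :=
            sum_le_sum (fun j hj => hbad i j (mem_filter.1 hj).2)
        _ ≤ ∑ _j : Fin (s + 1), 1 / (2 * ((s : ℝ) + 1)) * ((H i).card : ℝ) :=
            sum_le_sum_of_subset_of_nonneg (filter_subset _ _) (fun _ _ _ => by positivity)
        _ = 1 / 2 * (H i).card := by
            rw [sum_const, card_univ, Fintype.card_fin, nsmul_eq_mul]
            push_cast
            field_simp
    have h2 : ((H i).card : ℝ) ≤
        ((univ.filter (fun j => i ≠ j)).biUnion (bad i)).card + (K i).card := by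
      have := card_le_card_sdiff_add_card
        (s := H i) (t := (univ.filter (fun j => i ≠ j)).biUnion (bad i))
      rw [add_comm]
      exact_mod_cast this
    linarith
  have hKne : ∀ i, Nonempty (K i) := by
    intro i
    have h1 : (0 : ℝ) < (H i).card := by exact_mod_cast (hH i).1.card_pos
    have h2 := hK i
    have h3 : (0 : ℝ) < (K i).card := by linarith
    obtain ⟨F, hF⟩ := card_pos.1 (by exact_mod_cast h3 : 0 < (K i).card)
    exact ⟨⟨F, hF⟩⟩
  have hcardK : ∀ i, ∀ F : K i, ((F : Finset V) \ X i).card ≤ k := by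
    intro i F
    exact (card_le_card sdiff_subset).trans (hk _ (hHR i (mem_sdiff.1 F.2).1))
  -- Keeping at least half of `H i` costs a factor 2, which is absorbed by 2^|Z| when Z is nonempty;
  -- hence τ/2 in place of τ.
  have hspread : ∀ i Z, ((univ.filter (fun F : K i => Z ⊆ (F : Finset V) \ X i)).card : ℝ) *
      (τ / 2) ^ Z.card ≤ Fintype.card (K i) := by
    intro i Z
    rw [Fintype.card_coe]
    rcases Z.eq_empty_or_nonempty with hZ | hZ
    · subst hZ
      simp
    by_cases hd : Disjoint Z (X i)
    · have h1 : ((univ : Finset (K i)).filter (fun F : K i => Z ⊆ (F : Finset V) \ X i)).card ≤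
          ((H i).filter (fun F => Z ⊆ F)).card := by
        refine card_le_card_of_injOn (fun F => (F : Finset V)) ?_
          (fun _ _ _ _ h => Subtype.ext h)
        intro F hF
        rw [mem_coe, mem_filter] at hF ⊢
        exact ⟨(mem_sdiff.1 F.2).1, hF.2.trans sdiff_subset⟩
      have h2 := (hH i).2.2 Z hd
      have h3 : (2 : ℝ) ≤ 2 ^ Z.card := by
        calc (2 : ℝ) = 2 ^ 1 := by norm_num
          _ ≤ _ := pow_le_pow_right₀ (by norm_num) hZ.card_pos
      rw [div_pow, ← mul_div_assoc, div_le_iff₀ (by positivity)]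
      calc _ ≤ (((H i).filter (fun F => Z ⊆ F)).card : ℝ) * τ ^ Z.card := by gcongr
        _ ≤ (H i).card := h2
        _ ≤ 2 * (K i).card := hK i
        _ ≤ (K i).card * 2 ^ Z.card := by rw [mul_comm]; gcongr
    · have h1 : (univ : Finset (K i)).filter (fun F : K i => Z ⊆ (F : Finset V) \ X i) = ∅ := by
        rw [filter_eq_empty_iff]
        intro F _ h
        exact hd (disjoint_sdiff_self_left.mono_left h)
      rw [h1]
      simp
  obtain ⟨ω, hω⟩ := exists_pairwise_disjoint_of_spread (Ω := fun i => K i)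
    (fun i F => (F : Finset V) \ X i) (k := k) (m := m) (R := τ / 2)
    (by rw [Fintype.card_fin]; push_cast; linarith) hcardK hspread (by rw [Fintype.card_fin]; exact hm)
  obtain ⟨i, j, hij, hcard⟩ := hν (fun i => ω i)
    (fun i => hHR i ((mem_sdiff.1 (ω i).2).1))
  have hgood : ∀ i j, i ≠ j → ((ω i : Finset V) ∩ (X j \ X i)).card < b i j := by
    intro i j hij
    by_contra hlt
    have h1 := mem_sdiff.1 (ω i).2
    exact h1.2 (mem_biUnion.2 ⟨j, mem_filter.2 ⟨mem_univ _, hij⟩,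
      mem_filter.2 ⟨h1.1, not_lt.1 hlt⟩⟩)
  have h1 : (ω i : Finset V) ∩ (ω j : Finset V) ⊆
      (X i ∩ X j) ∪ ((ω i : Finset V) ∩ (X j \ X i)) ∪ ((ω j : Finset V) ∩ (X i \ X j)) := by
    intro x hx
    have h2 := mem_inter.1 hx
    have h3 : x ∈ (ω i : Finset V) \ X i → x ∉ (ω j : Finset V) \ X j :=
      fun h => disjoint_left.1 (hω i j hij.ne) h
    simp only [mem_sdiff, mem_union, mem_inter] at h3 ⊢
    tauto
  have h2 := (card_le_card h1).trans (card_union_le _ _)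
  have h3 := card_union_le (X i ∩ X j) ((ω i : Finset V) ∩ (X j \ X i))
  have h4 := hgood i j hij.ne
  have h5 := hgood j i hij.ne'
  have h6 := hsep i j hij.ne
  simp only [b] at h4 h5
  rw [inter_comm (X j) (X i)] at h5
  omega

end Cores

/-- A greedy selection argument for a relation without `s + 1` independent elements. -/
theorem card_le_mul_of_no_independent {α : Type*} (near : α → α → Prop)
    [DecidableRel near] (f : α → ℕ) (M : ℕ) (s : ℕ) (G : Finset α)
    (hG : ∀ v : Fin (s + 1) → α, (∀ i, v i ∈ G) → ∃ i j, i < j ∧ near (v i) (v j))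
    (hM : ∀ v ∈ G, (G.filter (fun u => near v u ∧ f v ≤ f u)).card ≤ M) :
    G.card ≤ s * M := by
  induction s generalizing G with
  | zero =>
    rcases G.eq_empty_or_nonempty with h | ⟨v, hv⟩
    · simp [h]
    · obtain ⟨i, j, hij, -⟩ := hG (fun _ => v) (fun _ => hv)
      omega
  | succ s ih =>
    rcases G.eq_empty_or_nonempty with h | hne
    · simp [h]
    -- Minimality of `f v` makes the side condition f v ≤ f u automatic, so `hM` bounds all of the
    -- elements near v.
    obtain ⟨v, hv, hmin⟩ := exists_min_image G f hne
    have h1 : (G.filter (fun u => near v u)).card ≤ M := by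
      refine (card_le_card ?_).trans (hM v hv)
      intro u hu
      rw [mem_filter] at hu ⊢
      exact ⟨hu.1, hu.2, hmin u hu.1⟩
    have h2 := ih (G.filter (fun u => ¬ near v u)) ?_ ?_
    · rw [← card_filter_add_card_filter_not (s := G) (fun u => near v u)]
      linarith
    · intro w hw
      obtain ⟨i, j, hij, hnear⟩ := hG (Fin.cons v w) (by
        intro i
        refine Fin.cases hv (fun i => ?_) i
        exact (mem_filter.1 (hw i)).1)
      obtain ⟨j, rfl⟩ := Fin.exists_succ_eq.2 (Fin.ne_zero_of_lt hij)
      rcases Fin.eq_zero_or_eq_succ i with rfl | ⟨i, rfl⟩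
      · exact absurd hnear (mem_filter.1 (hw j)).2
      · exact ⟨i, j, Fin.succ_lt_succ_iff.1 hij, hnear⟩
    · intro u hu
      refine (card_le_card ?_).trans (hM u (mem_filter.1 hu).1)
      exact filter_subset_filter _ (filter_subset _ _)

/-- Each step multiplies the binomial coefficient by (b-i)/(a-i) ≤ b/a. -/
theorem choose_sub_mul_pow_le {a b x : ℕ} (hba : b ≤ a) (hx : x ≤ b) :
    (a - x).choose (b - x) * a ^ x ≤ a.choose b * b ^ x := by
  induction x with
  | zero => simp
  | succ x ih =>
    have ih' := ih (by omega)
    obtain ⟨p, hp⟩ : ∃ p, a - x = p + 1 := ⟨a - x - 1, by omega⟩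
    obtain ⟨q, hq⟩ : ∃ q, b - x = q + 1 := ⟨b - x - 1, by omega⟩
    have hp' : a - (x + 1) = p := by omega
    have hq' : b - (x + 1) = q := by omega
    rw [hp, hq] at ih'
    rw [hp', hq']
    have h1 := Nat.add_one_mul_choose_eq p q
    have h2 : (q + 1) * a ≤ (p + 1) * b := by
      have ha : a = p + 1 + x := by omega
      have hb : b = q + 1 + x := by omega
      have hqp : q ≤ p := by omega
      rw [ha, hb]
      nlinarith [Nat.mul_le_mul_right x hqp]
    have h3 : p.choose q * a ≤ (p + 1).choose (q + 1) * b := by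
      refine Nat.le_of_mul_le_mul_left ?_ (show 0 < p + 1 by omega)
      calc (p + 1) * (p.choose q * a) = (p + 1) * p.choose q * a := by ring
        _ = (p + 1).choose (q + 1) * ((q + 1) * a) := by rw [h1]; ring
        _ ≤ (p + 1).choose (q + 1) * ((p + 1) * b) := Nat.mul_le_mul_left _ h2
        _ = _ := by ring
    calc p.choose q * a ^ (x + 1) = p.choose q * a * a ^ x := by ring
      _ ≤ (p + 1).choose (q + 1) * b * a ^ x := Nat.mul_le_mul_right _ h3
      _ = (p + 1).choose (q + 1) * a ^ x * b := by ring
      _ ≤ a.choose b * b ^ x * b := Nat.mul_le_mul_right _ ih'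
      _ = _ := by ring

/-! ### Counting the members of a family whose cores are all large -/

section Counting

variable {V : Type*} [DecidableEq V]

theorem card_containing_le [Fintype V] {R : Finset (Finset V)} {k : ℕ}
    (hR : R ⊆ powersetCard k univ) (X : Finset V) :
    (containing R X).card ≤ (Fintype.card V - X.card).choose (k - X.card) := by
  rw [← card_compl, ← card_powersetCard]
  refine card_le_card_of_injOn (fun F => F \ X) ?_ ?_
  · intro F hF
    obtain ⟨h1, h2⟩ := mem_containing.1 (mem_coe.1 hF)
    have h3 := (mem_powersetCard.1 (hR h1)).2
    rw [mem_coe, mem_powersetCard]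
    refine ⟨fun x hx => mem_compl.2 (mem_sdiff.1 hx).2, ?_⟩
    rw [card_sdiff_of_subset h2, h3]
  · intro F hF F' hF' h
    have h1 := (mem_containing.1 (mem_coe.1 hF)).2
    have h2 := (mem_containing.1 (mem_coe.1 hF')).2
    rw [← sdiff_union_of_subset h1, ← sdiff_union_of_subset h2]
    exact congrArg (· ∪ X) h

theorem card_containing_mul_pow_le [Fintype V] {R : Finset (Finset V)} {k t : ℕ} (htk : t < k)
    (hkn : k ≤ Fintype.card V) (hR : R ⊆ powersetCard k univ) (X : Finset V) (hX : t ≤ X.card) :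
    ((containing R X).card : ℝ) *
        (((Fintype.card V : ℝ) - t) / ((k : ℝ) - t)) ^ (X.card - t)
      ≤ ((Fintype.card V - t).choose (k - t) : ℝ) := by
  set n := Fintype.card V with hn
  have hkt : (0 : ℝ) < (k : ℝ) - t := by
    have : (t : ℝ) < k := by exact_mod_cast htk
    linarith
  by_cases hXk : X.card ≤ k
  · have h1 := card_containing_le hR X
    have h2 := choose_sub_mul_pow_le (a := n - t) (b := k - t) (x := X.card - t)
      (by omega) (by omega)
    have h3 : n - t - (X.card - t) = n - X.card := by omega
    have h4 : k - t - (X.card - t) = k - X.card := by omega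
    rw [h3, h4] at h2
    have h5 := (Nat.mul_le_mul_right ((n - t) ^ (X.card - t)) h1).trans h2
    have h6 : ((containing R X).card : ℝ) * ((n : ℝ) - t) ^ (X.card - t) ≤
        ((n - t).choose (k - t) : ℝ) * ((k : ℝ) - t) ^ (X.card - t) := by
      rw [← Nat.cast_sub (by omega : t ≤ n), ← Nat.cast_sub htk.le]
      exact_mod_cast h5
    rw [div_pow, ← mul_div_assoc, div_le_iff₀ (by positivity)]
    exact h6
  · have h1 : containing R X = ∅ := by
      rw [eq_empty_iff_forall_notMem]
      intro F hF
      obtain ⟨h1, h2⟩ := mem_containing.1 hF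
      have h3 := (mem_powersetCard.1 (hR h1)).2
      have h4 := card_le_card h2
      omega
    rw [h1]
    simp

/-- Pass from Y to a core X above it. The degree bound at X uses r where the weight uses τ, so each
of the at least d elements of X beyond t gains a factor τ/r. -/
theorem card_containing_mul_pow_le_of_cores [Fintype V] {R : Finset (Finset V)} {t d : ℕ}
    {r τ N : ℝ} (hτ : 0 < τ) (hτr : τ ≤ r)
    (hdeg : ∀ X : Finset V, t ≤ X.card → ((containing R X).card : ℝ) * r ^ (X.card - t) ≤ N)
    (hN : 0 ≤ N) (hcore : ∀ X, IsCore τ R X → t + d ≤ X.card) (Y : Finset V) :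
    ((containing R Y).card : ℝ) * τ ^ Y.card ≤ N * τ ^ t * (τ / r) ^ d := by
  have hr : 0 < r := hτ.trans_le hτr
  rcases (containing R Y).eq_empty_or_nonempty with h | h
  · rw [h]
    simp only [card_empty, Nat.cast_zero, zero_mul]
    positivity
  obtain ⟨X, -, hX, h1⟩ := exists_isCore_superset hτ R Y h
  have h2 := hcore X hX
  obtain ⟨x, hx⟩ : ∃ x, X.card = t + x := ⟨X.card - t, by omega⟩
  have h3 := hdeg X (by omega)
  have h4 : X.card - t = x := by omega
  rw [h4] at h3
  refine h1.trans ?_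
  rw [hx, pow_add]
  have h5 : (τ / r) ^ x * r ^ x = τ ^ x := by rw [← mul_pow, div_mul_cancel₀ _ hr.ne']
  have h6 : (τ / r) ^ x ≤ (τ / r) ^ d :=
    pow_le_pow_of_le_one (by positivity) ((div_le_one hr).2 hτr) (by omega)
  calc ((containing R X).card : ℝ) * (τ ^ t * τ ^ x)
      = ((containing R X).card * r ^ x) * (τ ^ t * (τ / r) ^ x) := by
        rw [← h5]; ring
    _ ≤ N * (τ ^ t * (τ / r) ^ d) :=
        mul_le_mul h3 (mul_le_mul_of_nonneg_left h6 (by positivity)) (by positivity) hN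
    _ = _ := by ring

theorem sum_powerset_inv_pow_card_sdiff (B I : Finset V) (hI : I ⊆ B) (τ : ℝ) :
    ∑ Y ∈ B.powerset, (τ⁻¹) ^ (I \ Y).card = 2 ^ (B \ I).card * (1 + τ⁻¹) ^ I.card := by
  have h1 := prod_add (fun _ : V => (1 : ℝ)) (fun x => if x ∈ I then τ⁻¹ else 1) B
  have h2 : ∏ x ∈ B, ((1 : ℝ) + if x ∈ I then τ⁻¹ else 1) =
      2 ^ (B \ I).card * (1 + τ⁻¹) ^ I.card := by
    rw [← prod_sdiff hI]
    congr 1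
    · rw [← prod_const]
      refine prod_congr rfl (fun x hx => ?_)
      rw [if_neg (mem_sdiff.1 hx).2]
      norm_num
    · rw [← prod_const]
      refine prod_congr rfl (fun x hx => ?_)
      rw [if_pos hx]
  rw [← h2, h1]
  refine sum_congr rfl (fun Y _ => ?_)
  rw [prod_const_one, one_mul, prod_ite, prod_const, prod_const_one, mul_one]
  congr 2
  ext x
  simp only [mem_sdiff, mem_filter]
  constructor
  · exact fun h => ⟨⟨hI h.1, h.2⟩, h.1⟩
  · exact fun h => ⟨h.2, h.1.2⟩

/-- Classify F by its trace Y on X₁ ∪ X₂. With I = X₁ ∩ X₂, inclusion-exclusion gives |Y| + h ≥ t +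
|I \ Y|, so every point of I missed by Y costs a factor τ. Summing over traces therefore costs (1 +
1/τ) per point of I, and 2 only for the at most 4d + 2h points outside I. -/
theorem card_filter_near_pair_le [Fintype V] {R : Finset (Finset V)} {t d h : ℕ}
    {r τ N : ℝ} (hτ : 1 ≤ τ) (hτr : τ ≤ r)
    (hdeg : ∀ X : Finset V, t ≤ X.card → ((containing R X).card : ℝ) * r ^ (X.card - t) ≤ N)
    (hN : 0 ≤ N) (hcore : ∀ X, IsCore τ R X → t + d ≤ X.card) {X₁ X₂ : Finset V}
    (h₁ : X₁.card ≤ t + 2 * d) (h₂ : X₂.card ≤ t + 2 * d) (h₁₂ : t ≤ (X₁ ∩ X₂).card + h) :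
    ((R.filter (fun F => (X₁ ∩ X₂).card ≤ (F ∩ X₁).card ∧ t ≤ (F ∩ X₂).card + h)).card : ℝ)
      ≤ N * τ ^ h * (τ / r) ^ d * (2 ^ (4 * d + 2 * h) * (1 + τ⁻¹) ^ (t + 2 * d)) := by
  have hτ0 : 0 < τ := by linarith
  have hr0 : 0 < r := by linarith
  set I := X₁ ∩ X₂ with hI
  set B := X₁ ∪ X₂ with hB
  set P : Finset V → Prop := fun Y => I.card ≤ (Y ∩ X₁).card ∧ t ≤ (Y ∩ X₂).card + h with hP
  have hsub : R.filter (fun F => I.card ≤ (F ∩ X₁).card ∧ t ≤ (F ∩ X₂).card + h) ⊆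
      (B.powerset.filter P).biUnion (fun Y => containing R Y) := by
    intro F hF
    rw [mem_filter] at hF
    rw [mem_biUnion]
    refine ⟨F ∩ B, ?_, mem_containing.2 ⟨hF.1, inter_subset_left⟩⟩
    rw [mem_filter, mem_powerset]
    refine ⟨inter_subset_right, ?_⟩
    have e1 : F ∩ B ∩ X₁ = F ∩ X₁ := by
      rw [inter_assoc, hB, inter_eq_right.2 subset_union_left]
    have e2 : F ∩ B ∩ X₂ = F ∩ X₂ := by
      rw [inter_assoc, hB, inter_eq_right.2 subset_union_right]
    simp only [hP]
    rw [e1, e2]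
    exact hF.2
  have hterm : ∀ Y ∈ B.powerset.filter P, ((containing R Y).card : ℝ) ≤
      N * τ ^ h * (τ / r) ^ d * (τ⁻¹) ^ (I \ Y).card := by
    intro Y hY
    rw [mem_filter, mem_powerset] at hY
    obtain ⟨hYB, hY1, hY2⟩ := hY
    have c1 : (Y ∩ X₁ ∪ Y ∩ X₂).card + (Y ∩ X₁ ∩ (Y ∩ X₂)).card =
        (Y ∩ X₁).card + (Y ∩ X₂).card := card_union_add_card_inter _ _
    have c2 : Y ∩ X₁ ∪ Y ∩ X₂ = Y := by
      rw [← inter_union_distrib_left]; exact inter_eq_left.2 hYB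
    have c3 : Y ∩ X₁ ∩ (Y ∩ X₂) = I ∩ Y := by
      ext x; simp only [hI, mem_inter]; tauto
    have c4 : (I \ Y).card + (I ∩ Y).card = I.card := card_sdiff_add_card_inter _ _
    rw [c2, c3] at c1
    have c5 : t + (I \ Y).card ≤ Y.card + h := by omega
    have h3 := card_containing_mul_pow_le_of_cores hτ0 hτr hdeg hN hcore Y
    have h4 : ((containing R Y).card : ℝ) * τ ^ (t + (I \ Y).card) ≤
        (N * τ ^ h * (τ / r) ^ d) * τ ^ t := by
      calc ((containing R Y).card : ℝ) * τ ^ (t + (I \ Y).card)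
          ≤ ((containing R Y).card : ℝ) * τ ^ (Y.card + h) := by
            gcongr
        _ = ((containing R Y).card : ℝ) * τ ^ Y.card * τ ^ h := by ring
        _ ≤ N * τ ^ t * (τ / r) ^ d * τ ^ h := by gcongr
        _ = _ := by ring
    rw [inv_pow, ← div_eq_mul_inv, le_div_iff₀ (by positivity)]
    rw [pow_add, mul_comm (τ ^ t), ← mul_assoc] at h4
    exact le_of_mul_le_mul_right h4 (by positivity)
  have hBI : (B \ I).card ≤ 4 * d + 2 * h := by
    have c1 : (B \ I).card + I.card = B.card :=
      card_sdiff_add_card_eq_card (inter_subset_left.trans subset_union_left)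
    have c2 : B.card + I.card = X₁.card + X₂.card := card_union_add_card_inter _ _
    omega
  have hIc : I.card ≤ t + 2 * d := (card_le_card inter_subset_left).trans h₁
  calc _ ≤ ∑ Y ∈ B.powerset.filter P, ((containing R Y).card : ℝ) := by
        exact_mod_cast (card_le_card hsub).trans card_biUnion_le
    _ ≤ ∑ Y ∈ B.powerset.filter P, N * τ ^ h * (τ / r) ^ d * (τ⁻¹) ^ (I \ Y).card :=
        sum_le_sum hterm
    _ ≤ ∑ Y ∈ B.powerset, N * τ ^ h * (τ / r) ^ d * (τ⁻¹) ^ (I \ Y).card :=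
        sum_le_sum_of_subset_of_nonneg (filter_subset _ _) (fun _ _ _ => by positivity)
    _ = N * τ ^ h * (τ / r) ^ d * (2 ^ (B \ I).card * (1 + τ⁻¹) ^ I.card) := by
        rw [← mul_sum,
          sum_powerset_inv_pow_card_sdiff B I (inter_subset_left.trans subset_union_left)]
    _ ≤ _ := by
        have : (1 : ℝ) ≤ 1 + τ⁻¹ := by
          have : (0 : ℝ) ≤ τ⁻¹ := by positivity
          linarith
        gcongr
        norm_num

/-- The cores of `R` with at most `m` elements. -/
noncomputable def coresOfCardLE [Fintype V] (τ : ℝ) (R : Finset (Finset V)) (m : ℕ) :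
    Finset (Finset V) :=
  @Finset.filter _ (fun X => IsCore τ R X ∧ X.card ≤ m) (Classical.decPred _) univ

theorem mem_coresOfCardLE [Fintype V] {τ : ℝ} {R : Finset (Finset V)} {m : ℕ} {X : Finset V} :
    X ∈ coresOfCardLE τ R m ↔ IsCore τ R X ∧ X.card ≤ m := by
  rw [coresOfCardLE, @mem_filter _ _ (Classical.decPred _), and_iff_right (mem_univ _)]

theorem lt_card_of_isCore_sdiff [Fintype V] {τ : ℝ} {R : Finset (Finset V)} {m : ℕ}
    {X : Finset V} (hX : IsCore τ (R \ containingSome R (coresOfCardLE τ R m)) X) :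
    m < X.card := by
  by_contra hle
  obtain ⟨F, hF, hXF⟩ := hX.exists_subset
  rw [mem_sdiff, mem_containingSome] at hF
  exact hF.2 ⟨hF.1, X, mem_coresOfCardLE.2 ⟨hX.mono sdiff_subset, not_lt.1 hle⟩, hXF⟩

/-- Attach to each member F a small core X F. Among any s+1 of these cores two are near, so greedy
selection costs a factor s. It is applied twice: to F₁, and then, among members near F₁, to F₂ with
|X F₂ ∩ X F₁| minimal. The minimality gives |F ∩ X F₁| ≥ |X F₁ ∩ X F₂| for the members counted,
which is what the pair estimate needs. -/
theorem card_containingSome_coresOfCardLE_le [Fintype V] {R : Finset (Finset V)}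
    {s t k m d h : ℕ} {r τ N : ℝ}
    (hν : ∀ A : Fin (s + 1) → Finset V, (∀ i, A i ∈ R) → ∃ i j, i < j ∧ t ≤ (A i ∩ A j).card)
    (hk : ∀ F ∈ R, F.card ≤ k)
    (hτ1 : 2 ^ 12 * (((s : ℝ) + 1) * (m + 1)) ≤ τ) (hm : (s + 1) * k < 2 ^ (m + 1))
    (hτ2 : 12 * ((s : ℝ) + 1) * ((2 * d : ℝ) / (h + 1) + 1) ≤ τ) (hτr : τ ≤ r)
    (hdeg : ∀ X : Finset V, t ≤ X.card → ((containing R X).card : ℝ) * r ^ (X.card - t) ≤ N)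
    (hN : 0 ≤ N) (hcore : ∀ X, IsCore τ R X → t + d ≤ X.card) :
    ((containingSome R (coresOfCardLE τ R (t + 2 * d))).card : ℝ) ≤ (s : ℝ) ^ 2 *
      (N * τ ^ h * (τ / r) ^ d * (2 ^ (4 * d + 2 * h) * (1 + τ⁻¹) ^ (t + 2 * d))) := by
  set G := containingSome R (coresOfCardLE τ R (t + 2 * d)) with hG
  set Q := N * τ ^ h * (τ / r) ^ d * (2 ^ (4 * d + 2 * h) * (1 + τ⁻¹) ^ (t + 2 * d)) with hQ
  have hGR : G ⊆ R := fun F hF => (mem_containingSome.1 hF).1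
  have hτ : 1 ≤ τ := by
    refine le_trans ?_ hτ1
    have h1 : (1 : ℝ) ≤ (s : ℝ) + 1 := by linarith [(Nat.cast_nonneg s : (0 : ℝ) ≤ s)]
    have h2 : (1 : ℝ) ≤ (m : ℝ) + 1 := by linarith [(Nat.cast_nonneg m : (0 : ℝ) ≤ m)]
    nlinarith [one_le_mul_of_one_le_of_one_le h1 h2]
  have hex : ∀ F, ∃ X, F ∈ G → (IsCore τ R X ∧ X.card ≤ t + 2 * d) ∧ X ⊆ F := by
    intro F
    by_cases hF : F ∈ G
    · obtain ⟨-, X, hX, hXF⟩ := mem_containingSome.1 hF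
      exact ⟨X, fun _ => ⟨mem_coresOfCardLE.1 hX, hXF⟩⟩
    · exact ⟨∅, fun h => absurd h hF⟩
  choose X hX using hex
  let near : Finset V → Finset V → Prop := fun F F' => t ≤ (X F ∩ X F').card + h
  have hind : ∀ v : Fin (s + 1) → Finset V, (∀ i, v i ∈ G) →
      ∃ i j, i < j ∧ near (v i) (v j) := by
    intro v hv
    obtain ⟨i, j, hij, h1⟩ := exists_lt_card_inter_add_of_isCore (e := h + 1) (d := 2 * d) hν hk
      (by omega) hτ1 hm (by push_cast; exact hτ2) (fun i => X (v i))
      (fun i => (hX _ (hv i)).1.1) (fun i => (hX _ (hv i)).1.2)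
    exact ⟨i, j, hij, by simp only [near]; omega⟩
  have hQ0 : 0 ≤ Q := by
    have : 0 ≤ τ := by linarith
    have : 0 ≤ r := by linarith
    positivity
  have hpair : ∀ F₁ ∈ G, ∀ F₂ ∈ G, near F₁ F₂ →
      ((G.filter (fun F => near F₁ F)).filter
        (fun F => near F₂ F ∧ (X F₂ ∩ X F₁).card ≤ (X F ∩ X F₁).card)).card ≤ ⌊Q⌋₊ := by
    intro F₁ hF₁ F₂ hF₂ h12
    refine Nat.le_floor ?_
    refine le_trans ?_ (card_filter_near_pair_le hτ hτr hdeg hN hcore (hX F₁ hF₁).1.2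
      (hX F₂ hF₂).1.2 h12)
    refine Nat.cast_le.2 (card_le_card (fun F hF => ?_))
    rw [mem_filter, mem_filter] at hF
    obtain ⟨⟨hFG, -⟩, h2, h3⟩ := hF
    have hXF := (hX F hFG).2
    refine mem_filter.2 ⟨hGR hFG, ?_, ?_⟩
    · rw [inter_comm]
      exact h3.trans (card_le_card (inter_subset_inter_right hXF))
    · refine h2.trans (Nat.add_le_add_right (card_le_card ?_) h)
      rw [inter_comm]
      exact inter_subset_inter_right hXF
  have hone : ∀ F₁ ∈ G, (G.filter (fun F => near F₁ F)).card ≤ s * ⌊Q⌋₊ := by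
    intro F₁ hF₁
    refine card_le_mul_of_no_independent near (fun F => (X F ∩ X F₁).card) ⌊Q⌋₊ s _ ?_ ?_
    · exact fun v hv => hind v (fun i => (mem_filter.1 (hv i)).1)
    · intro F₂ hF₂
      obtain ⟨h1, h2⟩ := mem_filter.1 hF₂
      exact hpair F₁ hF₁ F₂ h1 h2
  have htot := card_le_mul_of_no_independent near (fun _ => 0) (s * ⌊Q⌋₊) s G hind
    (fun F₁ hF₁ => by simpa only [le_refl, and_true] using hone F₁ hF₁)
  calc (G.card : ℝ) ≤ (s : ℝ) * (s * (⌊Q⌋₊ : ℝ)) := by exact_mod_cast htot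
    _ ≤ s * (s * Q) := by
        gcongr
        exact Nat.floor_le hQ0
    _ = _ := by ring

/-- If all cores of `R` are large then `R` is small. -/
theorem card_le_of_cores_large [Fintype V] {s t k m d₀ : ℕ} {r τ N : ℝ}
    (hτ1 : 2 ^ 12 * (((s : ℝ) + 1) * (m + 1)) ≤ τ) (hm : (s + 1) * k < 2 ^ (m + 1))
    (hτr : τ ≤ r) (hN : 0 ≤ N) (hd₀ : 1 ≤ d₀)
    (hparam : ∀ d : ℕ, d₀ ≤ d → ∃ h : ℕ,
      12 * ((s : ℝ) + 1) * ((2 * d : ℝ) / (h + 1) + 1) ≤ τ ∧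
      τ ^ h * (τ / r) ^ d * (2 ^ (4 * d + 2 * h) * (1 + τ⁻¹) ^ (t + 2 * d))
        ≤ (1 / 2) ^ (4 * d))
    (R : Finset (Finset V))
    (hν : ∀ A : Fin (s + 1) → Finset V, (∀ i, A i ∈ R) → ∃ i j, i < j ∧ t ≤ (A i ∩ A j).card)
    (hk : ∀ F ∈ R, F.card ≤ k)
    (hdeg : ∀ X : Finset V, t ≤ X.card → ((containing R X).card : ℝ) * r ^ (X.card - t) ≤ N)
    (d : ℕ) (hd : d₀ ≤ d) (hcore : ∀ X, IsCore τ R X → t + d ≤ X.card) :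
    (R.card : ℝ) ≤ 2 * (s : ℝ) ^ 2 * N * (1 / 2) ^ (4 * d) := by
  obtain ⟨j, hj⟩ : ∃ j, k < d + j := ⟨k + 1, by omega⟩
  -- In the base case d > k, so a member of R would contain a core and sit below k in size: R is
  -- empty. Otherwise cores up to t + 2d are removed and d doubles.
  induction j generalizing R d with
  | zero =>
    rcases R.eq_empty_or_nonempty with h | ⟨F, hF⟩
    · rw [h]
      simp only [card_empty, Nat.cast_zero]
      positivity
    · have hτ : 0 < τ := lt_of_lt_of_le (by positivity) hτ1
      obtain ⟨X, -, hX, -⟩ := exists_isCore_superset hτ R F ⟨F, mem_containing.2 ⟨hF, Subset.rfl⟩⟩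
      obtain ⟨F', hF', hXF'⟩ := hX.exists_subset
      have h1 := hcore X hX
      have h2 := card_le_card hXF'
      have h3 := hk F' hF'
      omega
  | succ j ih =>
    set G := containingSome R (coresOfCardLE τ R (t + 2 * d)) with hG
    have h1 := ih (R \ G) (fun A hA => hν A (fun i => (mem_sdiff.1 (hA i)).1))
      (fun F hF => hk F (mem_sdiff.1 hF).1)
      (fun X hX => by
        refine le_trans (mul_le_mul_of_nonneg_right (Nat.cast_le.2 (card_le_card ?_)) ?_)
          (hdeg X hX)
        · exact filter_subset_filter _ sdiff_subset
        · have : 0 ≤ r := le_trans (le_trans (by positivity) hτ1) hτr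
          positivity)
      (2 * d) (by omega) (fun X hX => (lt_card_of_isCore_sdiff hX).le) (by omega)
    obtain ⟨h, hh1, hh2⟩ := hparam d hd
    have h2 : (G.card : ℝ) ≤ (s : ℝ) ^ 2 * (N * (1 / 2) ^ (4 * d)) := by
      refine (card_containingSome_coresOfCardLE_le hν hk hτ1 hm hh1 hτr hdeg hN hcore).trans ?_
      rw [mul_assoc N, mul_assoc N]
      gcongr
    have h3 : (R.card : ℝ) ≤ (R \ G).card + G.card := by
      exact_mod_cast card_le_card_sdiff_add_card
    -- Doubling d at least halves the bound, so 2s² reproduces itself: s² from the rest, s² from the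
    -- part removed.
    have h4 : ((1 : ℝ) / 2) ^ (4 * (2 * d)) ≤ 1 / 2 * (1 / 2) ^ (4 * d) := by
      rw [← pow_succ']
      apply pow_le_pow_of_le_one (by norm_num) (by norm_num)
      omega
    calc (R.card : ℝ) ≤ (R \ G).card + G.card := h3
      _ ≤ 2 * (s : ℝ) ^ 2 * N * (1 / 2 * (1 / 2) ^ (4 * d)) +
          (s : ℝ) ^ 2 * (N * (1 / 2) ^ (4 * d)) := by
          gcongr
          exact h1.trans (by gcongr)
      _ = _ := by ring

end Counting

/-! ### Choice of parameters -/

theorem matchingNumber_le_iff {V : Type*} [DecidableEq V] {F : Finset (Finset V)} {t s : ℕ} :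
    matchingNumber F t ≤ s ↔
      ∀ A : Fin (s + 1) → Finset V, (∀ i, A i ∈ F) → ∃ i j, i < j ∧ t ≤ (A i ∩ A j).card := by
  constructor
  · intro h A hA
    by_contra! hcon
    have h1 : ((s + 1 : ℕ) : ℕ∞) ≤ matchingNumber F t :=
      le_iSup₂_of_le (s + 1) ⟨A, hA, hcon⟩ le_rfl
    have h2 : s + 1 ≤ s := by exact_mod_cast h1.trans h
    omega
  · intro h
    refine iSup₂_le (fun m hm => ?_)
    obtain ⟨A, hA, hA'⟩ := hm
    by_contra hlt
    have h1 : s + 1 ≤ m := by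
      have : (s : ℕ∞) < m := not_le.1 hlt
      exact_mod_cast this
    obtain ⟨i, j, hij, h2⟩ := h (fun i => A (Fin.castLE h1 i)) (fun i => hA _)
    have h3 := hA' (Fin.castLE h1 i) (Fin.castLE h1 j) hij
    omega

/-- In powers of 2 the four factors are at most d, -12d, 6d and d, for a total of -4d. The condition
on t keeps (1 + 1/τ)^(t+2d) below e^(d/2) ≤ 2^d. -/
theorem error_factor_le {d t h : ℕ} {r τ : ℝ} (hτ : 1 ≤ τ) (hr : r = 2 ^ 12 * τ)
    (hh : (h : ℝ) * Real.logb 2 r ≤ d) (ht : 2 * ((t : ℝ) + 2 * d) ≤ d * τ) :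
    τ ^ h * (τ / r) ^ d * (2 ^ (4 * d + 2 * h) * (1 + τ⁻¹) ^ (t + 2 * d))
      ≤ (1 / 2) ^ (4 * d) := by
  have hr0 : 0 < r := by rw [hr]; positivity
  have hlog : 1 ≤ Real.logb 2 r := by
    rw [Real.le_logb_iff_rpow_le (by norm_num) hr0, Real.rpow_one, hr]
    nlinarith
  have hhd : h ≤ d := by
    have h0 : (0 : ℝ) ≤ h := by positivity
    have : (h : ℝ) ≤ d := by nlinarith
    exact_mod_cast this
  have h1 : τ ^ h ≤ 2 ^ d := by
    calc τ ^ h ≤ r ^ h := by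
          gcongr
          rw [hr]; nlinarith
      _ = (2 : ℝ) ^ ((h : ℝ) * Real.logb 2 r) := by
          rw [mul_comm, Real.rpow_mul (by norm_num), Real.rpow_logb (by norm_num) (by norm_num) hr0,
            Real.rpow_natCast]
      _ ≤ (2 : ℝ) ^ (d : ℝ) := Real.rpow_le_rpow_of_exponent_le (by norm_num) hh
      _ = 2 ^ d := Real.rpow_natCast _ _
  have h2 : (τ / r) ^ d = (1 / 2) ^ (12 * d) := by
    have : τ / r = (1 / 2) ^ 12 := by
      rw [hr]; field_simp
    rw [this, ← pow_mul]
  have h3 : (1 + τ⁻¹) ^ (t + 2 * d) ≤ 2 ^ d := by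
    calc (1 + τ⁻¹) ^ (t + 2 * d) ≤ (Real.exp τ⁻¹) ^ (t + 2 * d) := by
          gcongr
          linarith [Real.add_one_le_exp τ⁻¹]
      _ = Real.exp ((t + 2 * d : ℕ) * τ⁻¹) := by rw [Real.exp_nat_mul]
      _ ≤ Real.exp (d * (1 / 2)) := by
          refine Real.exp_le_exp.2 ?_
          rw [← div_eq_mul_inv, div_le_iff₀ (by positivity)]
          push_cast
          linarith
      _ = (Real.exp (1 / 2)) ^ d := by rw [Real.exp_nat_mul]
      _ ≤ 2 ^ d := by
          gcongr
          have h5 : Real.exp (1 / 2) * Real.exp (1 / 2) = Real.exp 1 := by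
            rw [← Real.exp_add]; norm_num
          have h6 := Real.exp_one_lt_d9
          by_contra! h7
          nlinarith
  have h4 : (2 : ℝ) ^ (4 * d + 2 * h) ≤ 2 ^ (6 * d) :=
    pow_le_pow_right₀ (by norm_num) (by omega)
  calc τ ^ h * (τ / r) ^ d * (2 ^ (4 * d + 2 * h) * (1 + τ⁻¹) ^ (t + 2 * d))
      ≤ 2 ^ d * (1 / 2) ^ (12 * d) * (2 ^ (6 * d) * 2 ^ d) := by
        rw [h2]
        gcongr
    _ = 2 ^ (8 * d) * ((1 / 2) ^ (8 * d) * (1 / 2) ^ (4 * d)) := by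
        rw [show 12 * d = 8 * d + 4 * d by ring, show 8 * d = d + (6 * d + d) by ring]
        simp only [pow_add]
        ring
    _ = (1 / 2) ^ (4 * d) := by
        rw [← mul_assoc, ← mul_pow]; norm_num

/-- The parameter q stands for t^α s^β. It enters twice: st ≤ q² gives s·(t/q) ≤ q, so τ dominates
s·d₀; and t/q is part of the size allowance, so t = O(qd) = O(dτ), as the error factor requires. -/
theorem exists_approximating_family {n k s t : ℕ} {σ q : ℝ} (hs : 1 ≤ s) (ht : 1 ≤ t)
    (htk : t < k) (hkn : k ≤ n) (hσ : 0 ≤ σ) (hq : 0 < q) (hstq : (s : ℝ) * t ≤ q * q)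
    (hr1 : 2 ^ 30 * q ≤ ((n : ℝ) - t) / ((k : ℝ) - t))
    (hr2 : 2 ^ 30 * (s : ℝ) * (σ + Real.logb 2 n) ≤ ((n : ℝ) - t) / ((k : ℝ) - t))
    {F : Finset (Finset (Fin n))} (hF : F ⊆ powersetCard k univ)
    (hν : matchingNumber F t ≤ s) :
    ∃ S : Finset (Finset (Fin n)),
      (∀ A ∈ S, (A.card : ℝ) ≤ t + t / q + 3 * σ
        + Real.logb 2 (16 * (s : ℝ) ^ 4 * (t : ℝ) ^ 2)) ∧
      matchingNumber S t ≤ s ∧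
      ((F \ containingSome F S).card : ℝ) ≤ (2 : ℝ) ^ (-σ) * ((n - t).choose (k - t) : ℝ) := by
  rw [matchingNumber_le_iff] at hν
  have hk : ∀ A ∈ F, A.card ≤ k := fun A hA => (mem_powersetCard.1 (hF hA)).2.le
  have hdeg : ∀ X : Finset (Fin n), t ≤ X.card → ((containing F X).card : ℝ) *
      (((n : ℝ) - t) / ((k : ℝ) - t)) ^ (X.card - t) ≤ ((n - t).choose (k - t) : ℝ) := by
    intro X hX
    have := card_containing_mul_pow_le htk (by rw [Fintype.card_fin]; exact hkn) hF X hX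
    rwa [Fintype.card_fin] at this
  have hsR : (1 : ℝ) ≤ s := by exact_mod_cast hs
  have htR : (1 : ℝ) ≤ t := by exact_mod_cast ht
  have hn2 : (2 : ℝ) ≤ n := by exact_mod_cast (by omega : 2 ≤ n)
  have hrn : ((n : ℝ) - t) / ((k : ℝ) - t) ≤ n := by
    have h1 : (t : ℝ) + 1 ≤ k := by exact_mod_cast htk
    rw [div_le_iff₀ (by linarith)]
    nlinarith
  set N : ℝ := ((n - t).choose (k - t) : ℝ) with hN
  set r := ((n : ℝ) - t) / ((k : ℝ) - t) with hr
  set l := Real.logb 2 n with hl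
  have hl1 : 1 ≤ l := by
    rw [hl, Real.le_logb_iff_rpow_le (by norm_num) (by linarith), Real.rpow_one]
    exact hn2
  have hsl : 2 ^ 30 * ((s : ℝ) * l) ≤ r := by
    have : 0 ≤ (s : ℝ) * σ := by positivity
    linarith
  have hsσ : 2 ^ 30 * ((s : ℝ) * σ) ≤ r := by
    have : 0 ≤ (s : ℝ) * l := by positivity
    linarith
  have hsl' : (s : ℝ) ≤ s * l := by nlinarith
  have hr30 : 2 ^ 30 ≤ r := by linarith
  have hsn : s ≤ n := by
    have : (s : ℝ) ≤ n := by linarith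
    exact_mod_cast this
  have hrl : Real.logb 2 r ≤ l :=
    Real.logb_le_logb_of_le (by norm_num) (by linarith) hrn
  have hlr : 1 ≤ Real.logb 2 r := by
    rw [Real.le_logb_iff_rpow_le (by norm_num) (by linarith), Real.rpow_one]
    linarith
  set τ := r / 2 ^ 12 with hτ
  have hτr : r = 2 ^ 12 * τ := by rw [hτ]; ring
  have hτr' : τ ≤ r := by linarith
  have hτ1 : 1 ≤ τ := by linarith
  -- number of exposure steps in the spread lemma
  set m := 2 * Nat.log 2 n + 2 with hm
  have hm1 : (s + 1) * k < 2 ^ (m + 1) := by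
    have h1 := Nat.lt_pow_succ_log_self (b := 2) (by norm_num) n
    calc (s + 1) * k ≤ (2 * n) * n := Nat.mul_le_mul (by omega) hkn
      _ < 2 * (2 ^ (Nat.log 2 n).succ * 2 ^ (Nat.log 2 n).succ) := by
          rw [mul_assoc]
          exact Nat.mul_lt_mul_of_pos_left (Nat.mul_lt_mul'' h1 h1) (by norm_num)
      _ = 2 ^ (m + 1) := by
          rw [hm, ← pow_add, ← pow_succ']
          congr 1
          omega
  have hm2 : 2 ^ 12 * (((s : ℝ) + 1) * (m + 1)) ≤ τ := by
    have h1 : (Nat.log 2 n : ℝ) ≤ l := by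
      have := Real.natLog_le_logb n 2
      exact_mod_cast this
    have h2 : (m : ℝ) + 1 ≤ 5 * l := by
      rw [hm]; push_cast; linarith
    calc 2 ^ 12 * (((s : ℝ) + 1) * (m + 1)) ≤ 2 ^ 12 * ((2 * s) * (5 * l)) := by
          gcongr
          linarith
      _ ≤ τ := by linarith
  set D := t / q + 3 * σ + Real.logb 2 (16 * (s : ℝ) ^ 4 * (t : ℝ) ^ 2) with hD
  have hlog4 : 4 ≤ Real.logb 2 (16 * (s : ℝ) ^ 4 * (t : ℝ) ^ 2) := by
    rw [Real.le_logb_iff_rpow_le (by norm_num) (by positivity)]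
    have h1 : (1 : ℝ) ≤ (s : ℝ) ^ 4 := one_le_pow₀ hsR
    have h2 : (1 : ℝ) ≤ (t : ℝ) ^ 2 := one_le_pow₀ htR
    calc (2 : ℝ) ^ (4 : ℝ) = 16 * 1 * 1 := by
          rw [show (4 : ℝ) = ((4 : ℕ) : ℝ) by norm_num, Real.rpow_natCast]; norm_num
      _ ≤ _ := by gcongr
  have hlog10 : Real.logb 2 (16 * (s : ℝ) ^ 4 * (t : ℝ) ^ 2) ≤ 10 * l := by
    have h1 : (s : ℝ) ≤ n := by exact_mod_cast hsn
    have h2 : (t : ℝ) ≤ n := by exact_mod_cast (by omega : t ≤ n)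
    calc Real.logb 2 (16 * (s : ℝ) ^ 4 * (t : ℝ) ^ 2)
        ≤ Real.logb 2 ((n : ℝ) ^ 10) := by
          refine Real.logb_le_logb_of_le (by norm_num) (by positivity) ?_
          calc 16 * (s : ℝ) ^ 4 * (t : ℝ) ^ 2 ≤ (n : ℝ) ^ 4 * (n : ℝ) ^ 4 * (n : ℝ) ^ 2 := by
                gcongr
                calc (16 : ℝ) = 2 ^ 4 := by norm_num
                  _ ≤ _ := by gcongr
            _ = _ := by ring
      _ = 10 * l := by rw [Real.logb_pow, hl]; norm_num
  have htq : 0 ≤ (t : ℝ) / q := by positivity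
  have hD0 : 0 ≤ D := by linarith
  set d₀ := ⌊D⌋₊ with hd₀
  have hd₀4 : 4 ≤ d₀ := Nat.le_floor (by push_cast; linarith)
  have hd₀D : (d₀ : ℝ) ≤ D := Nat.floor_le hD0
  have hDd₀ : D < d₀ + 1 := Nat.lt_floor_add_one D
  have hsD : (s : ℝ) * D ≤ q + 3 * (s * σ) + 10 * (s * l) := by
    have h1 : (s : ℝ) * (t / q) ≤ q := by
      rw [← mul_div_assoc, div_le_iff₀ hq]; exact hstq
    have h2 : (s : ℝ) * Real.logb 2 (16 * (s : ℝ) ^ 4 * (t : ℝ) ^ 2) ≤ s * (10 * l) := by gcongr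
    rw [hD]
    linarith
  refine ⟨coresOfCardLE τ F (t + d₀), ?_, ?_, ?_⟩
  · intro A hA
    have h1 : (A.card : ℝ) ≤ t + d₀ := by exact_mod_cast (mem_coresOfCardLE.1 hA).2
    linarith
  · rw [matchingNumber_le_iff]
    intro A hA
    -- With e = 1 no slack is lost in the intersections; the price is τ of order at least s·d₀,
    -- which `hsD` supplies.
    obtain ⟨i, j, hij, h1⟩ := exists_lt_card_inter_add_of_isCore (e := 1) (d := d₀) (τ := τ) hν hk
      le_rfl hm2 hm1 (by
        rw [Nat.cast_one, div_one]
        calc 12 * ((s : ℝ) + 1) * (d₀ + 1) ≤ 12 * (2 * s) * (D + 1) := by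
              gcongr
              linarith
          _ = 24 * (s * D) + 24 * s := by ring
          _ ≤ τ := by linarith)
      A (fun i => (mem_coresOfCardLE.1 (hA i)).1) (fun i => (mem_coresOfCardLE.1 (hA i)).2)
    exact ⟨i, j, hij, by omega⟩
  · have h1 := card_le_of_cores_large (d₀ := d₀) (t := t) (N := N) hm2 hm1 hτr' (by positivity)
      (by omega) ?_ (F \ containingSome F (coresOfCardLE τ F (t + d₀)))
      (fun A hA => hν A (fun i => (mem_sdiff.1 (hA i)).1))
      (fun A hA => hk A (mem_sdiff.1 hA).1)
      (fun X hX => by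
        refine le_trans (mul_le_mul_of_nonneg_right (Nat.cast_le.2 (card_le_card ?_)) ?_)
          (hdeg X hX)
        · exact filter_subset_filter _ sdiff_subset
        · have : 0 ≤ r := by linarith
          positivity)
      d₀ le_rfl (fun X hX => (lt_card_of_isCore_sdiff hX).le)
    · refine h1.trans ?_
      have h2 : ((1 : ℝ) / 2) ^ (4 * d₀) ≤
          (2 : ℝ) ^ (-σ) * (16 * (s : ℝ) ^ 4 * (t : ℝ) ^ 2)⁻¹ := by
        have h3 : (1 : ℝ) ≤ d₀ := by exact_mod_cast (by omega : 1 ≤ d₀)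
        calc ((1 : ℝ) / 2) ^ (4 * d₀) = (2 : ℝ) ^ (-((4 * d₀ : ℕ) : ℝ)) := by
              rw [Real.rpow_neg (by norm_num), Real.rpow_natCast, one_div, inv_pow]
          _ ≤ (2 : ℝ) ^ (-σ + -Real.logb 2 (16 * (s : ℝ) ^ 4 * (t : ℝ) ^ 2)) := by
              refine Real.rpow_le_rpow_of_exponent_le (by norm_num) ?_
              push_cast
              linarith
          _ = _ := by
              rw [Real.rpow_add (by norm_num), Real.rpow_neg (by norm_num) (Real.logb _ _),
                Real.rpow_logb (by norm_num) (by norm_num) (by positivity)]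
      have h4 : 2 * (s : ℝ) ^ 2 * (16 * (s : ℝ) ^ 4 * (t : ℝ) ^ 2)⁻¹ ≤ 1 := by
        rw [← div_eq_mul_inv, div_le_one (by positivity)]
        have h5 : (1 : ℝ) ≤ (t : ℝ) ^ 2 := one_le_pow₀ htR
        have h6 : (s : ℝ) ^ 2 ≤ (s : ℝ) ^ 4 := pow_le_pow_right₀ hsR (by norm_num)
        calc 2 * (s : ℝ) ^ 2 ≤ 16 * (s : ℝ) ^ 4 := by nlinarith [sq_nonneg (s : ℝ)]
          _ ≤ 16 * (s : ℝ) ^ 4 * (t : ℝ) ^ 2 := le_mul_of_one_le_right (by positivity) h5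
      have h7 : (0 : ℝ) < 2 ^ (-σ) := by positivity
      calc 2 * (s : ℝ) ^ 2 * N * (1 / 2) ^ (4 * d₀)
          ≤ 2 * (s : ℝ) ^ 2 * N * ((2 : ℝ) ^ (-σ) * (16 * (s : ℝ) ^ 4 * (t : ℝ) ^ 2)⁻¹) := by
            gcongr
        _ = 2 * (s : ℝ) ^ 2 * (16 * (s : ℝ) ^ 4 * (t : ℝ) ^ 2)⁻¹ * ((2 : ℝ) ^ (-σ) * N) := by ring
        _ ≤ 1 * ((2 : ℝ) ^ (-σ) * N) := by gcongr
        _ = _ := one_mul _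
    · intro d hd
      have hdR : (d₀ : ℝ) ≤ d := by exact_mod_cast hd
      have h4R : (4 : ℝ) ≤ d₀ := by exact_mod_cast hd₀4
      -- Slack proportional to d keeps the spreadness required of order s·log n at every scale,
      -- while τ^h ≤ r^h ≤ 2^d.
      refine ⟨⌊(d : ℝ) / Real.logb 2 r⌋₊, ?_, ?_⟩
      · have h1 := Nat.lt_floor_add_one ((d : ℝ) / Real.logb 2 r)
        set h := ⌊(d : ℝ) / Real.logb 2 r⌋₊
        have h2 : (2 * d : ℝ) / (h + 1) ≤ 2 * l := by
          rw [div_le_iff₀ (by positivity)]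
          rw [div_lt_iff₀ (by linarith)] at h1
          have h3 : ((h : ℝ) + 1) * Real.logb 2 r ≤ (h + 1) * l := by gcongr
          linarith
        calc 12 * ((s : ℝ) + 1) * ((2 * d : ℝ) / (h + 1) + 1)
            ≤ 12 * (2 * s) * (2 * l + l) := by
              gcongr
              linarith
          _ = 72 * (s * l) := by ring
          _ ≤ τ := by linarith
      · refine error_factor_le hτ1 hτr ?_ ?_
        · rw [← le_div_iff₀ (by linarith)]
          exact Nat.floor_le (by positivity)
        · have h1 : (t : ℝ) ≤ q * (2 * d) := by
            have h2 : (t : ℝ) / q ≤ 2 * d := by linarith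
            rw [div_le_iff₀ hq] at h2
            linarith
          have h2 : (d : ℝ) * (4 * q + 4) ≤ d * τ :=
            mul_le_mul_of_nonneg_left (by linarith) (by positivity)
          linarith

end SetFamily

/-! ### The theorem, reduced to q = t^α s^β -/

theorem mainTheorem3 :
    ∃ C : ℝ, 0 < C ∧
      ∀ (n k s t : ℕ) (σ : ℝ), 1 ≤ s → 1 ≤ t → t ≤ k → 0 ≤ σ → 2 ≤ (s : ℝ) * t + σ →
        (n : ℝ) ≥ t + C * ((s : ℝ) * t) ^ (1 / 2 : ℝ) * ((k : ℝ) - t)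
            * Real.logb 2 (((n : ℝ) - t) / ((k : ℝ) - t)) →
        (n : ℝ) ≥ k + C * ((k : ℝ) - t) * s * (σ + Real.logb 2 n) →
        ∀ F : Finset (Finset (Fin n)), F ⊆ Finset.powersetCard k Finset.univ →
          SetFamily.matchingNumber F t ≤ s →
          (∃ S : Finset (Finset (Fin n)),
            (∀ A ∈ S, (A.card : ℝ) ≤ t + ((t : ℝ) / s) ^ (1 / 2 : ℝ) + 3 * σ
                + Real.logb 2 (16 * (s : ℝ) ^ 4 * (t : ℝ) ^ 2)) ∧
            SetFamily.matchingNumber S t ≤ s ∧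
            ((F \ SetFamily.containingSome F S).card : ℝ) ≤
              (2 : ℝ) ^ (-σ) * (15 * Real.logb 2 ((s : ℝ) * t + σ))
                * ((n - t).choose (k - t) : ℝ)) ∧
          (∀ α β : ℝ, 1 / 2 ≤ α → 1 / 2 ≤ β →
            (n : ℝ) ≥ t + C * (t : ℝ) ^ α * (s : ℝ) ^ β * ((k : ℝ) - t)
                * Real.logb 2 (((n : ℝ) - t) / ((k : ℝ) - t)) →
            ∃ S : Finset (Finset (Fin n)),
              (∀ A ∈ S, (A.card : ℝ) ≤ t + (t : ℝ) ^ (1 - α) * (s : ℝ) ^ (-β) + 3 * σ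
                  + Real.logb 2 (16 * (s : ℝ) ^ 4 * (t : ℝ) ^ 2)) ∧
              SetFamily.matchingNumber S t ≤ s ∧
              ((F \ SetFamily.containingSome F S).card : ℝ) ≤
                (2 : ℝ) ^ (-σ) * (15 * Real.logb 2 ((s : ℝ) * t + σ))
                  * ((n - t).choose (k - t) : ℝ)) := by
  -- A factor 2^12 is spent on r/τ; the remaining 2^18 covers the constants in the lower bounds on
  -- τ.
  refine ⟨2 ^ 30, by norm_num, ?_⟩
  intro n k s t σ hs ht htk hσ hst h1 h2 F hF hν
  have hsR : (1 : ℝ) ≤ s := by exact_mod_cast hs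
  have htR : (1 : ℝ) ≤ t := by exact_mod_cast ht
  have hs0 : (0 : ℝ) < s := by linarith
  have ht0 : (0 : ℝ) < t := by linarith
  have hlog : 1 ≤ Real.logb 2 ((s : ℝ) * t + σ) := by
    rw [Real.le_logb_iff_rpow_le (by norm_num) (by linarith), Real.rpow_one]
    exact hst
  have hlog16 : 0 ≤ Real.logb 2 (16 * (s : ℝ) ^ 4 * (t : ℝ) ^ 2) := by
    refine Real.logb_nonneg (by norm_num) ?_
    have h3 : (1 : ℝ) ≤ (s : ℝ) ^ 4 := one_le_pow₀ hsR
    have h4 : (1 : ℝ) ≤ (t : ℝ) ^ 2 := one_le_pow₀ htR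
    calc (1 : ℝ) ≤ 16 * 1 * 1 := by norm_num
      _ ≤ _ := by gcongr
  have key : ∀ α β : ℝ, 1 / 2 ≤ α → 1 / 2 ≤ β →
      (n : ℝ) ≥ t + 2 ^ 30 * (t : ℝ) ^ α * (s : ℝ) ^ β * ((k : ℝ) - t)
          * Real.logb 2 (((n : ℝ) - t) / ((k : ℝ) - t)) →
      ∃ S : Finset (Finset (Fin n)),
        (∀ A ∈ S, (A.card : ℝ) ≤ t + (t : ℝ) ^ (1 - α) * (s : ℝ) ^ (-β) + 3 * σ
            + Real.logb 2 (16 * (s : ℝ) ^ 4 * (t : ℝ) ^ 2)) ∧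
        SetFamily.matchingNumber S t ≤ s ∧
        ((F \ SetFamily.containingSome F S).card : ℝ) ≤
          (2 : ℝ) ^ (-σ) * (15 * Real.logb 2 ((s : ℝ) * t + σ))
            * ((n - t).choose (k - t) : ℝ) := by
    intro α β hα hβ h3
    rcases htk.eq_or_lt with rfl | htk'
    -- For k = t the members of F already have size t, so F approximates itself with nothing left
    -- over.
    · refine ⟨F, ?_, hν, ?_⟩
      · intro A hA
        rw [(Finset.mem_powersetCard.1 (hF hA)).2]
        have : 0 ≤ (t : ℝ) ^ (1 - α) * (s : ℝ) ^ (-β) := by positivity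
        linarith
      · have h4 : F \ SetFamily.containingSome F F = ∅ := by
          rw [Finset.sdiff_eq_empty_iff_subset]
          exact fun A hA => SetFamily.mem_containingSome.2 ⟨hA, A, hA, Finset.Subset.rfl⟩
        rw [h4]
        simp only [Finset.card_empty, Nat.cast_zero]
        positivity
    · have hkt : (0 : ℝ) < (k : ℝ) - t := by
        have : (t : ℝ) < k := by exact_mod_cast htk'
        linarith
      have hln : 0 ≤ Real.logb 2 (n : ℝ) := by
        rcases Nat.eq_zero_or_pos n with rfl | hn
        · simp
        · exact Real.logb_nonneg (by norm_num) (by exact_mod_cast hn)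
      have hkn : k ≤ n := by
        have h4 : 0 ≤ 2 ^ 30 * ((k : ℝ) - t) * s * (σ + Real.logb 2 n) := by positivity
        have : (k : ℝ) ≤ n := by linarith
        exact_mod_cast this
      set q : ℝ := (t : ℝ) ^ α * (s : ℝ) ^ β with hq
      have hq0 : 0 < q := by positivity
      have hr2 : 2 ^ 30 * (s : ℝ) * (σ + Real.logb 2 n) ≤ ((n : ℝ) - t) / ((k : ℝ) - t) := by
        rw [le_div_iff₀ hkt]
        linarith
      -- The logarithm in the hypothesis is at least 1 and is dropped.
      have hr1 : 2 ^ 30 * q ≤ ((n : ℝ) - t) / ((k : ℝ) - t) := by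
        have h4 : 2 ^ 30 * q * Real.logb 2 (((n : ℝ) - t) / ((k : ℝ) - t)) ≤
            ((n : ℝ) - t) / ((k : ℝ) - t) := by
          rw [le_div_iff₀ hkt]
          linarith
        have h5 : 1 ≤ Real.logb 2 (n : ℝ) := by
          have hn2 : (2 : ℝ) ≤ n := by exact_mod_cast (by omega : 2 ≤ n)
          rw [Real.le_logb_iff_rpow_le (by norm_num) (by linarith), Real.rpow_one]
          exact hn2
        have h6 : (2 : ℝ) ≤ ((n : ℝ) - t) / ((k : ℝ) - t) := by
          refine le_trans ?_ hr2
          have : (1 : ℝ) ≤ s * (σ + Real.logb 2 n) :=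
            one_le_mul_of_one_le_of_one_le hsR (by linarith)
          linarith
        have h7 : 1 ≤ Real.logb 2 (((n : ℝ) - t) / ((k : ℝ) - t)) := by
          rw [Real.le_logb_iff_rpow_le (by norm_num) (by linarith), Real.rpow_one]
          exact h6
        exact (le_mul_of_one_le_right (by positivity) h7).trans h4
      -- This is where α, β ≥ 1/2 enters.
      have hstq : (s : ℝ) * t ≤ q * q := by
        have h4 : ∀ x γ : ℝ, 1 ≤ x → 1 / 2 ≤ γ → x ≤ x ^ γ * x ^ γ := by
          intro x γ hx hγ
          rw [← Real.rpow_add (by linarith)]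
          calc x = x ^ (1 : ℝ) := (Real.rpow_one x).symm
            _ ≤ x ^ (γ + γ) := Real.rpow_le_rpow_of_exponent_le hx (by linarith)
        calc (s : ℝ) * t ≤ ((s : ℝ) ^ β * (s : ℝ) ^ β) * ((t : ℝ) ^ α * (t : ℝ) ^ α) :=
              mul_le_mul (h4 _ _ hsR hβ) (h4 _ _ htR hα) (by positivity) (by positivity)
          _ = q * q := by rw [hq]; ring
      obtain ⟨S, hS1, hS2, hS3⟩ := SetFamily.exists_approximating_family hs ht htk' hkn hσ hq0 hstq
        hr1 hr2 hF hν
      have htq : (t : ℝ) / q = (t : ℝ) ^ (1 - α) * (s : ℝ) ^ (-β) := by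
        rw [Real.rpow_sub ht0, Real.rpow_one, Real.rpow_neg hs0.le, hq]
        field_simp
      refine ⟨S, fun A hA => by rw [← htq]; exact hS1 A hA, hS2, hS3.trans ?_⟩
      gcongr
      exact le_mul_of_one_le_right (by positivity) (by linarith)
  refine ⟨?_, key⟩
  have h3 := key (1 / 2) (1 / 2) le_rfl le_rfl (by
    rw [Real.mul_rpow hs0.le ht0.le] at h1
    refine le_trans (le_of_eq ?_) h1
    ring)
  have h4 : (t : ℝ) ^ (1 - 1 / 2 : ℝ) * (s : ℝ) ^ (-(1 / 2) : ℝ) = ((t : ℝ) / s) ^ (1 / 2 : ℝ) := by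
    rw [Real.div_rpow ht0.le hs0.le, Real.rpow_neg hs0.le, ← div_eq_mul_inv,
      show (1 - 1 / 2 : ℝ) = 1 / 2 by norm_num]
  rw [h4] at h3
  exact h3
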